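/- Let $k>0$ and $\mu>0$. A Keplerian ellipse with the origin as focus is described by $E=(L,G,Z,g,z)$ with $L=k\sqrt a$, $G=k\sqrt{a(1-e^2)}$, $Z=G\cos I$, $g=\omega$, $z=\Omega$, where $(a,e,I,\omega,\Omega)$ are the Keplerian elements, $0\le e<1$; $\mathcal X(E,\ell)\in\mathbb R^3$ is the position at mean anomaly $\ell$. For a configuration $\mathcal E=(E,E')$ (asteroid, planet) and $V=(\ell,\ell')$ put $\Delta(\mathcal E,V)=\mathcal X(E,\ell)-\mathcal X(E',\ell')$, $d(\mathcal E,V)=|\Delta(\mathcal E,V)|$, and let $d_{min}(\mathcal E)$ be the minimum of the values of $d(\mathcal E,\cdot)$ at the local minimum points of $d^2(\mathcal E,\cdot)$. The configuration is non-degenerate if all critical points of $V\mapsto d^2(\mathcal E,V)$ are non-degenerate. If $V_h=(\ell_h,\ell_h')$ is a continuous branch $\mathcal E\mapsto V_h(\mathcal E)$ of local minimum points of $d^2(\mathcal E,\cdot)$, let $d_h(\mathcal E)=d(\mathcal E,V_h(\mathcal E))$, $\Delta_h(\mathcal E)=\Delta(\mathcal E,V_h(\mathcal E))$, $\tau_3=\partial_\ell\mathcal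 X(E,\ell_h)\times\partial_{\ell'}\mathcal X(E',\ell_h')$, and let the signed distance be $$\tilde d_h=\Bigl(\frac{\tau_3}{|\tau_3|}\cdot\frac{\Delta_h}{|\Delta_h|}\Bigr)d_h ,\qquad \tilde d_h=0\ \text{ where } d_h=0 .$$ Let $$R=\mu k^2\Bigl(\frac1{|\mathcal X-\mathcal X'|}-\frac{\mathcal X\cdot\mathcal X'}{|\mathcal X'|^3}\Bigr),\qquad \mathcal X=\mathcal X(E,\ell),\ \mathcal X'=\mathcal X(E',\ell'),$$ and, for $Y=(G,Z,g,z)$ the elements of the asteroid, let $\overline{\partial_y R}=\frac1{(2\pi)^2}\int_{[-\pi,\pi]^2}\partial_yR\,d\ell\,d\ell'$ for $y\in\{G,Z,g,z\}$. Let $a>0$, let $I\subset\mathbb R$ be an open interval and let $E'(t)$, $t\in I$, be the given evolution of the planet's orbit, whose Keplerian elements $(a',e',I',\omega',\Omega')$, $0\le e'<1$, are $C^1$ functions of $t$. A continuous $\overline Y=(\overline G,\overline Z,\overline g,\overline z):I\to\mathbb R^4$ with $0<\overline G<k\sqrt a$ and $|\overline Z|<\overline G$ on $I$ defines $\overline{\mathcal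 E}(t)=\bigl((k\sqrt a,\overline Y(t)),E'(t)\bigr)$ and the set of crossing times $T(\overline Y)=\{t\in I: d_{min}(\overline{\mathcal E}(t))=0\}$. It is a generalized solution of the averaged equations if all points of $T(\overline Y)$ are isolated, $$\dot{\overline G}=\overline{\partial_gR},\quad \dot{\overline Z}=\overline{\partial_zR},\quad \dot{\overline g}=-\overline{\partial_GR},\quad \dot{\overline z}=-\overline{\partial_ZR}\qquad\text{(evaluated at } \overline{\mathcal E}(t))$$ hold in the classical sense on $I\setminus T(\overline Y)$, and for each $t_c\in T(\overline Y)$ the limits of $\dot{\overline Y}(t)$ as $t\to t_c^+$ and as $t\to t_c^-$ exist and are finite. **Proposition.** Let $\overline Y$ be a generalized solution, and let $t_c\in T(\overline Y)$ be such that $\mathcal E_c=\overline{\mathcal E}(t_c)$ is non-degenerate and its two trajectories have exactly one point in common. Let $V_h$ be a continuous branch of local minimum points of $d^2$, defined in a neighborhood $\mathcal W$ of $\mathcal E_c$ (in the set of configurations $(E,E')$ with $0<e<1$, $0<I<\pi$, $0\le e'<1$), with $d_h(\mathcal E_c)=0$. Then there are $t_a<t_c<t_b$ such that $(t_a,t_b)\subset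 I$, $\overline{\mathcal E}(t)\in\mathcal W$ for $t\in(t_a,t_b)$, and $t\mapsto\tilde d_h(\overline{\mathcal E}(t))$ is of class $C^1$ on $(t_a,t_b)$. -/

import Mathlib

open Set Filter Topology MeasureTheory

noncomputable section

namespace SecularOrbit

/-- Three-dimensional Euclidean space. -/
abbrev Space : Type := EuclideanSpace ℝ (Fin 3)

/-- The cross product on Euclidean space. -/
def cross (x y : Space) : Space :=
  WithLp.toLp 2 (crossProduct (WithLp.ofLp x) (WithLp.ofLp y))

/-! ### Keplerian motion -/

/-- For `0 ≤ e < 1` Kepler's equation `u - e sin u = ℓ` has exactly one solution. -/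
theorem kepler_existsUnique {e : ℝ} (h0 : 0 ≤ e) (h1 : e < 1) (l : ℝ) :
    ∃! u : ℝ, u - e * Real.sin u = l := by
  have hc : Continuous (fun u : ℝ => u - e * Real.sin u) := by fun_prop
  have hd : ∀ u : ℝ, HasDerivAt (fun u : ℝ => u - e * Real.sin u) (1 - e * Real.cos u) u :=
    fun u => (hasDerivAt_id u).sub ((Real.hasDerivAt_sin u).const_mul e)
  have hmono : StrictMono (fun u : ℝ => u - e * Real.sin u) := by
    refine strictMono_of_deriv_pos fun u => ?_
    rw [(hd u).deriv]
    nlinarith [Real.cos_le_one u]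
  obtain ⟨u, -, hu⟩ := intermediate_value_Icc (a := l - 1) (b := l + 1) (by linarith)
    hc.continuousOn (show l ∈ _ from
      ⟨by nlinarith [Real.neg_one_le_sin (l - 1), Real.sin_le_one (l - 1)],
       by nlinarith [Real.neg_one_le_sin (l + 1), Real.sin_le_one (l + 1)]⟩)
  exact ⟨u, hu, fun v hv => hmono.injective (hv.trans hu.symm)⟩

/-- The eccentric anomaly `u` as a function of eccentricity and mean anomaly `l`: the
solution of Kepler's equation `u - e sin u = l`. -/
def eccentricAnomaly (e l : ℝ) : ℝ :=
  Function.invFun (fun u : ℝ => u - e * Real.sin u) l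

/-- Cartesian position, with origin in the focus, on the elliptic orbit with semimajor axis `a`,
eccentricity `e`, inclination `i`, argument of perihelion `ω`, longitude of the ascending node
`Ω`, at mean anomaly `l`. -/
def keplerPosition (a e i ω Ω l : ℝ) : Space :=
  let u := eccentricAnomaly e l
  (a * (Real.cos u - e)) •
      !₂[Real.cos ω * Real.cos Ω - Real.sin ω * Real.sin Ω * Real.cos i,
         Real.cos ω * Real.sin Ω + Real.sin ω * Real.cos Ω * Real.cos i,
         Real.sin ω * Real.sin i] +
    (a * Real.sqrt (1 - e ^ 2) * Real.sin u) •
      !₂[-(Real.sin ω * Real.cos Ω) - Real.cos ω * Real.sin Ω * Real.cos i,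
         -(Real.sin ω * Real.sin Ω) + Real.cos ω * Real.cos Ω * Real.cos i,
         Real.cos ω * Real.sin i]

/-- The elements `(L, Y)`, `Y = (G, Z, g, z)`, describing a Keplerian trajectory: Delaunay's
elements without the mean anomaly. -/
abbrev Elements : Type := ℝ × (Fin 4 → ℝ)

/-- The elliptic trajectories: `0 < G ≤ L` and `|Z| ≤ G`, i.e. `0 ≤ e < 1` and `0 ≤ I ≤ π`. -/
def ellipticDomain : Set Elements :=
  {E | 0 < E.2 0 ∧ E.2 0 ≤ E.1 ∧ |E.2 1| ≤ E.2 0}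

/-- The domain where Delaunay's elements are regular coordinates: `0 < G < L` and `|Z| < G`,
i.e. `0 < e < 1` and `0 < I < π`. -/
def delaunayDomain : Set Elements :=
  {E | 0 < E.2 0 ∧ E.2 0 < E.1 ∧ |E.2 1| < E.2 0}

/-- Semimajor axis, from `L = k √a`. -/
def semimajorAxis (k : ℝ) (E : Elements) : ℝ := E.1 ^ 2 / k ^ 2

/-- Eccentricity, from `G = L √(1 - e²)`. -/
def eccentricity (E : Elements) : ℝ := Real.sqrt (1 - (E.2 0 / E.1) ^ 2)

/-- Inclination, from `Z = G cos I`. -/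
def inclination (E : Elements) : ℝ := Real.arccos (E.2 1 / E.2 0)

/-- The Keplerian elements `(a, e, I, ω, Ω)` of a trajectory; `g = ω` and `z = Ω`. -/
def keplerElements (k : ℝ) (E : Elements) : ℝ × ℝ × ℝ × ℝ × ℝ :=
  (semimajorAxis k E, eccentricity E, inclination E, E.2 2, E.2 3)

/-- Cartesian position as a function of Delaunay's elements `(L, G, Z, l, g, z)`. -/
def position (k : ℝ) (E : Elements) (l : ℝ) : Space :=
  keplerPosition (semimajorAxis k E) (eccentricity E) (inclination E) (E.2 2) (E.2 3) l

/-! ### The two-orbit configuration and the orbit distance -/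

/-- A two-orbit configuration `(E, E')`: elements of the asteroid and of the planet. -/
abbrev Config : Type := Elements × Elements

/-- The admissible configurations. For the planet, circular orbits and orbits in the reference
plane are allowed. -/
def configDomain : Set Config := delaunayDomain ×ˢ ellipticDomain

/-- The vector `Δ = X - X'` at the mean anomalies `V = (l, l')`. -/
def separation (k : ℝ) (C : Config) (V : ℝ × ℝ) : Space :=
  position k C.1 V.1 - position k C.2 V.2

/-- The Keplerian distance function `d`. -/
def keplerDist (k : ℝ) (C : Config) (V : ℝ × ℝ) : ℝ :=
  ‖separation k C V‖

/-- The orbit distance: the least value of `d` at the local minimum points of `d²`. -/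
def orbitDist (k : ℝ) (C : Config) : ℝ :=
  sInf {r | ∃ V, IsLocalMin (fun W => keplerDist k C W ^ 2) V ∧ r = keplerDist k C V}

/-- All the critical points of `V ↦ d²(C, V)` are non-degenerate (the Hessian has trivial
kernel). -/
def IsNondegenerate (k : ℝ) (C : Config) : Prop :=
  ∀ V : ℝ × ℝ, fderiv ℝ (fun W => keplerDist k C W ^ 2) V = 0 →
    ∀ w : ℝ × ℝ, fderiv ℝ (fderiv ℝ (fun W => keplerDist k C W ^ 2)) V w = 0 → w = 0

/-- The two trajectories have exactly one point of space in common. -/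
def HasOneCrossingPoint (k : ℝ) (C : Config) : Prop :=
  ∃! x : Space, x ∈ range (position k C.1) ∧ x ∈ range (position k C.2)

/-- `Vh` is a (continuous) branch, on the set `W` of configurations, of local minimum points of
the squared Keplerian distance. -/
structure IsMinimumBranch (k : ℝ) (W : Set Config) (Vh : Config → ℝ × ℝ) : Prop where
  continuousOn : ContinuousOn Vh W
  isLocalMin : ∀ C ∈ W, IsLocalMin (fun V => keplerDist k C V ^ 2) (Vh C)

/-- The vector `τ₃ = τ₁ × τ₂`, where `τ₁ = ∂X/∂l` and `τ₂ = ∂X'/∂l'` are the vectors tangent to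
the two trajectories. -/
def normalVector (k : ℝ) (C : Config) (V : ℝ × ℝ) : Space :=
  cross (deriv (position k C.1) V.1) (deriv (position k C.2) V.2)

/-- The distance with sign `(τ̂₃ · Δ̂_h) d_h` attached to the branch `Vh` (zero where `d_h = 0`);
a hat denotes normalization. -/
def signedOrbitDist (k : ℝ) (Vh : Config → ℝ × ℝ) (C : Config) : ℝ :=
  inner ℝ (‖normalVector k C (Vh C)‖⁻¹ • normalVector k C (Vh C))
      (‖separation k C (Vh C)‖⁻¹ • separation k C (Vh C)) * keplerDist k C (Vh C)

/-! ### The averaged equations and their generalized solutions -/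

/-- The perturbing function `R = μ k² (1 / |X - X'| - X · X' / |X'|³)`. -/
def perturbingFunction (k μ : ℝ) (C : Config) (V : ℝ × ℝ) : ℝ :=
  μ * k ^ 2 * (1 / ‖position k C.1 V.1 - position k C.2 V.2‖ -
    inner ℝ (position k C.1 V.1) (position k C.2 V.2) / ‖position k C.2 V.2‖ ^ 3)

/-- The partial derivative of `R` with respect to the `j`-th component of the asteroid elements
`Y = (G, Z, g, z)`. -/
def partialR (k μ : ℝ) (C : Config) (V : ℝ × ℝ) (j : Fin 4) : ℝ :=
  fderiv ℝ (fun Y : Fin 4 → ℝ => perturbingFunction k μ ((C.1.1, Y), C.2) V) C.1.2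
    (Pi.single j 1)

/-- The average over the torus of the partial derivative of `R`. -/
def averagedPartialR (k μ : ℝ) (C : Config) (j : Fin 4) : ℝ :=
  1 / (2 * Real.pi) ^ 2 *
    ∫ V in Icc (-Real.pi) Real.pi ×ˢ Icc (-Real.pi) Real.pi, partialR k μ C V j

/-- The right-hand side `-J₂ (averaged ∇_Y R)` of the averaged equations
`Ġ = ∂R/∂g`, `Ż = ∂R/∂z`, `ġ = -∂R/∂G`, `ż = -∂R/∂Z` (with averaged partial derivatives). -/
def averagedField (k μ : ℝ) (C : Config) : Fin 4 → ℝ :=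
  ![averagedPartialR k μ C 2, averagedPartialR k μ C 3,
    -averagedPartialR k μ C 0, -averagedPartialR k μ C 1]

/-- The configuration `(E(t), E'(t))`, `E(t) = (k √a, Y(t))`, of an evolution `Y` of the asteroid
with semimajor axis `a` and an evolution `E'` of the planet. -/
def evolution (k a : ℝ) (E' : ℝ → Elements) (Y : ℝ → Fin 4 → ℝ) (t : ℝ) : Config :=
  ((k * Real.sqrt a, Y t), E' t)

/-- The set `T(Y)` of crossing times in the interval `I`. -/
def crossingTimes (k a : ℝ) (E' : ℝ → Elements) (I : Set ℝ) (Y : ℝ → Fin 4 → ℝ) : Set ℝ :=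
  {t | t ∈ I ∧ orbitDist k (evolution k a E' Y t) = 0}

/-- `Y` is a generalized solution, on the open interval `I`, of the averaged equations. -/
structure IsGeneralizedSolution (k μ a : ℝ) (E' : ℝ → Elements) (I : Set ℝ)
    (Y : ℝ → Fin 4 → ℝ) : Prop where
  continuousOn : ContinuousOn Y I
  mem_domain : ∀ t ∈ I, (k * Real.sqrt a, Y t) ∈ delaunayDomain
  /-- Crossing times are isolated. -/
  isolated : ∀ t ∈ crossingTimes k a E' I Y, ∀ᶠ s in 𝓝[≠] t, s ∉ crossingTimes k a E' I Y
  /-- Classical solution away from the crossing times. -/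
  solves : ∀ t ∈ I \ crossingTimes k a E' I Y,
    HasDerivAt Y (averagedField k μ (evolution k a E' Y t)) t
  right_limit : ∀ t ∈ crossingTimes k a E' I Y, ∃ v, Tendsto (deriv Y) (𝓝[>] t) (𝓝 v)
  left_limit : ∀ t ∈ crossingTimes k a E' I Y, ∃ v, Tendsto (deriv Y) (𝓝[<] t) (𝓝 v)

end SecularOrbit

end

/-!
The signed distance is a smooth function `D` of the elements of the two orbits near the crossing
configuration (`exists_signed_distance`): by the implicit function theorem the critical point `V_h`
of the distance depends smoothly on the elements, and at a critical point the vector `Δ_h` is a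
multiple of the unit common normal `ν`, so that the signed distance is `⟨ν, Δ_h⟩`. Along a solution
its time derivative is the sum of a term coming from the motion of the planet, which is continuous,
and of the term `⟨ν, ∂_Y X (Ẏ)⟩`, where `Ẏ` is the averaged vector field, which in general jumps
at the crossing.

The equations being Hamiltonian, the second term is the average of the derivative of `R` in the
direction `w = J ∇_Y D`, and this direction is tangent to the level sets of `D`, because `J` is
antisymmetric. So `⟨Δ_h, ∂_w X⟩ = 0` at `V_h`. The derivative of `1 / |Δ|` in the direction `w` is
`-⟨Δ, ∂_w X⟩ / |Δ|³`, which at `V_h + v` has size `|v|⁻²`: this is not integrable in two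
dimensions, uniformly in time. But the torus is symmetric about `V_h`, the integral may be taken
over the even part in `v`, and by the tangency and the orthogonality of `Δ_h` to the two orbits the
even part is at most of size `|v|⁻¹` (`kernel_add_kernel_le`), uniformly near the crossing. By
dominated convergence the average is continuous across the crossing
(`CrossingData.exists_continuousOn_integral`). The derivative of the signed distance, which exists
off the crossing time, thus extends continuously, and the signed distance is `C¹`
(`contDiffOn_of_hasDerivAt_of_ne`).

Non-degeneracy of the configuration makes the tangent vectors at the crossing independent, which
gives the lower bound `|Δ| ≥ c |v|` near the crossing point
(`CrossingData.exists_norm_gap_ge`); away from it the bound holds because there is no other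
crossing point. The position is treated throughout as a smooth function `orbitMap` of the Keplerian
elements on the open set `|e| < 1`, so that circular and planar orbits of the planet need no
special care.
-/

noncomputable section

namespace SecularOrbit

open scoped ContDiff

/-! ### Cross product -/

lemma inner_eq_sum (x y : Space) : inner ℝ x y = x 0 * y 0 + x 1 * y 1 + x 2 * y 2 := by
  simp [PiLp.inner_apply, Fin.sum_univ_three, mul_comm]

lemma cross_apply_zero (x y : Space) : cross x y 0 = x 1 * y 2 - x 2 * y 1 := by
  simp [cross, cross_apply]

lemma cross_apply_one (x y : Space) : cross x y 1 = x 2 * y 0 - x 0 * y 2 := by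
  simp [cross, cross_apply]

lemma cross_apply_two (x y : Space) : cross x y 2 = x 0 * y 1 - x 1 * y 0 := by
  simp [cross, cross_apply]

lemma inner_cross_left (x y : Space) : inner ℝ (cross x y) x = 0 := by
  rw [inner_eq_sum, cross_apply_zero, cross_apply_one, cross_apply_two]; ring

lemma inner_cross_right (x y : Space) : inner ℝ (cross x y) y = 0 := by
  rw [inner_eq_sum, cross_apply_zero, cross_apply_one, cross_apply_two]; ring

/-- A vector orthogonal to `x` and `y` is parallel to `x × y`. -/
lemma norm_cross_sq_smul {x y u : Space} (hx : inner ℝ u x = 0) (hy : inner ℝ u y = 0) :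
    ‖cross x y‖ ^ 2 • u = inner ℝ (cross x y) u • cross x y := by
  rw [← real_inner_self_eq_norm_sq]
  rw [inner_eq_sum] at hx hy
  ext i
  fin_cases i <;>
    simp only [Fin.zero_eta, Fin.mk_one, Fin.reduceFinMk, PiLp.smul_apply, smul_eq_mul,
      inner_eq_sum, cross_apply_zero, cross_apply_one, cross_apply_two]
  · linear_combination ((x 0 * y 1 - x 1 * y 0) * y 1 - (x 2 * y 0 - x 0 * y 2) * y 2) * hx +
      ((x 2 * y 0 - x 0 * y 2) * x 2 - (x 0 * y 1 - x 1 * y 0) * x 1) * hy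
  · linear_combination ((x 1 * y 2 - x 2 * y 1) * y 2 - (x 0 * y 1 - x 1 * y 0) * y 0) * hx +
      ((x 0 * y 1 - x 1 * y 0) * x 0 - (x 1 * y 2 - x 2 * y 1) * x 2) * hy
  · linear_combination ((x 2 * y 0 - x 0 * y 2) * y 0 - (x 1 * y 2 - x 2 * y 1) * y 1) * hx +
      ((x 1 * y 2 - x 2 * y 1) * x 1 - (x 2 * y 0 - x 0 * y 2) * x 0) * hy

lemma cross_ne_zero {x y : Space} (h : ∀ a b : ℝ, a • x = b • y → a = 0 ∧ b = 0) :
    cross x y ≠ 0 := by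
  have h1 : LinearIndependent ℝ ![WithLp.ofLp x, WithLp.ofLp y] := by
    rw [LinearIndependent.pair_iff]
    intro s t hst
    have := h s (-t) (by
      have h2 : s • x + t • y = 0 := by
        ext i; simpa using congrFun hst i
      rw [neg_smul]; exact eq_neg_of_add_eq_zero_left h2)
    exact ⟨this.1, neg_eq_zero.1 this.2⟩
  have h2 := crossProduct_ne_zero_iff_linearIndependent.2 h1
  intro h3
  apply h2
  have := congrArg WithLp.ofLp h3
  simpa [cross] using this

lemma contDiffAt_cross {E : Type*} [NormedAddCommGroup E] [NormedSpace ℝ E] {n : ℕ∞ω}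
    {f g : E → Space} {p : E} (hf : ContDiffAt ℝ n f p) (hg : ContDiffAt ℝ n g p) :
    ContDiffAt ℝ n (fun q => cross (f q) (g q)) p := by
  rw [contDiffAt_euclidean] at *
  intro i
  fin_cases i
  · simp only [Fin.zero_eta, cross_apply_zero]
    exact ((hf 1).mul (hg 2)).sub ((hf 2).mul (hg 1))
  · simp only [Fin.mk_one, cross_apply_one]
    exact ((hf 2).mul (hg 0)).sub ((hf 0).mul (hg 2))
  · simp only [Fin.reduceFinMk, cross_apply_two]
    exact ((hf 0).mul (hg 1)).sub ((hf 1).mul (hg 0))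

lemma continuous_cross : Continuous (fun z : Space × Space => cross z.1 z.2) :=
  continuous_iff_continuousAt.2 fun z =>
    (contDiffAt_cross (n := 0) (f := fun z : Space × Space => z.1) (g := fun z => z.2) (p := z)
      contDiffAt_fst contDiffAt_snd).continuousAt

/-! ### Implicit functions in finite dimension -/

/-- The implicit function theorem when the unknown lies in a finite dimensional space and the
partial derivative of the equation in the unknown is injective. -/
lemma exists_implicit_function {P Q : Type*} [NormedAddCommGroup P] [NormedSpace ℝ P]
    [CompleteSpace P] [NormedAddCommGroup Q] [NormedSpace ℝ Q] [FiniteDimensional ℝ Q]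
    {n : ℕ∞ω} (hn : n ≠ 0) {Φ : P × Q → Q} {p : P} {q : Q} (hΦ : ContDiffAt ℝ n Φ (p, q))
    (h0 : Φ (p, q) = 0) (hinj : ∀ w : Q, fderiv ℝ Φ (p, q) (0, w) = 0 → w = 0) :
    ∃ g : P → Q, ContDiffAt ℝ n g p ∧ g p = q ∧ (∀ᶠ x in 𝓝 p, Φ (x, g x) = 0) ∧
      ∀ᶠ x in 𝓝 (p, q), Φ x = 0 → x.2 = g x.1 := by
  have : CompleteSpace Q := FiniteDimensional.complete ℝ Q
  have hinv : (fderiv ℝ Φ (p, q) ∘L .inr ℝ P Q).IsInvertible := by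
    have hi : Function.Injective (fderiv ℝ Φ (p, q) ∘L .inr ℝ P Q : Q →L[ℝ] Q).toLinearMap := by
      rw [injective_iff_map_eq_zero]
      intro w hw
      exact hinj w (by simpa using hw)
    exact ⟨(LinearEquiv.ofInjectiveEndo _ hi).toContinuousLinearEquiv, by ext; simp⟩
  refine ⟨hΦ.implicitFunction hn hinv, hΦ.contDiffAt_implicitFunction hn hinv,
    hΦ.implicitFunction_apply_self hn hinv, ?_, ?_⟩
  · filter_upwards [hΦ.eventually_apply_implicitFunction hn hinv] with x hx
    rw [hx, h0]
  · filter_upwards [hΦ.eventually_apply_eq_iff_implicitFunction hn hinv] with x hx hx0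
    exact (hx.1 (hx0.trans h0.symm)).symm

/-! ### Families of curves depending smoothly on a parameter -/

section Family

variable {P F : Type*} [NormedAddCommGroup P] [NormedSpace ℝ P] [NormedAddCommGroup F]
  [NormedSpace ℝ F]

/-- The partial derivative in the real (angular) variable of a function of a parameter and an
angle. -/
def angleDeriv (f : P × ℝ → F) (q : P × ℝ) : F := fderiv ℝ f q (0, 1)

/-- The partial derivative in the parameter of a function of a parameter and an angle. -/
def paramDeriv (f : P × ℝ → F) (q : P × ℝ) : P →L[ℝ] F := fderiv ℝ f q ∘L .inl ℝ P ℝ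

variable {O : Set P} {f : P × ℝ → F}

lemma contDiffOn_angleDeriv (hO : IsOpen O) (hf : ContDiffOn ℝ ∞ f (O ×ˢ univ)) :
    ContDiffOn ℝ ∞ (angleDeriv f) (O ×ˢ univ) :=
  (hf.fderiv_of_isOpen (hO.prod isOpen_univ) (m := ∞) le_rfl).clm_apply contDiffOn_const

lemma contDiffOn_paramDeriv (hO : IsOpen O) (hf : ContDiffOn ℝ ∞ f (O ×ˢ univ)) :
    ContDiffOn ℝ ∞ (paramDeriv f) (O ×ˢ univ) :=
  (hf.fderiv_of_isOpen (hO.prod isOpen_univ) (m := ∞) le_rfl).clm_comp contDiffOn_const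

lemma differentiableAt_family (hO : IsOpen O) (hf : ContDiffOn ℝ ∞ f (O ×ˢ univ)) {p : P}
    (hp : p ∈ O) (l : ℝ) : DifferentiableAt ℝ f (p, l) :=
  (hf.contDiffAt ((hO.prod isOpen_univ).mem_nhds ⟨hp, mem_univ l⟩)).differentiableAt (by simp)

lemma hasDerivAt_angle (hO : IsOpen O) (hf : ContDiffOn ℝ ∞ f (O ×ˢ univ)) {p : P}
    (hp : p ∈ O) (l : ℝ) : HasDerivAt (fun s => f (p, s)) (angleDeriv f (p, l)) l :=
  (differentiableAt_family hO hf hp l).hasFDerivAt.comp_hasDerivAt l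
    ((hasDerivAt_const l p).prodMk (hasDerivAt_id l))

lemma hasFDerivAt_param (hO : IsOpen O) (hf : ContDiffOn ℝ ∞ f (O ×ˢ univ)) {p : P}
    (hp : p ∈ O) (l : ℝ) : HasFDerivAt (fun x => f (x, l)) (paramDeriv f (p, l)) p :=
  (differentiableAt_family hO hf hp l).hasFDerivAt.comp p (hasFDerivAt_prodMk_left p l)

lemma continuousAt_family (hO : IsOpen O) (hf : ContDiffOn ℝ ∞ f (O ×ˢ univ)) {p : P}
    (hp : p ∈ O) (l : ℝ) : ContinuousAt f (p, l) :=
  (differentiableAt_family hO hf hp l).continuousAt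

/-- Mean value inequality from the origin. -/
lemma norm_le_of_hasDerivAt {h h' : ℝ → F} {B a : ℝ} (h0 : h 0 = 0)
    (hd : ∀ s, |s| ≤ |a| → HasDerivAt h (h' s) s) (hB : ∀ s, |s| ≤ |a| → ‖h' s‖ ≤ B) :
    ‖h a‖ ≤ B * |a| := by
  have := (convex_Icc (-|a|) |a|).norm_image_sub_le_of_norm_hasDerivWithin_le
    (f := h) (f' := h') (C := B) (x := 0) (y := a)
    (fun s hs => (hd s (abs_le.2 hs)).hasDerivWithinAt) (fun s hs => hB s (abs_le.2 hs))
    ⟨by simp, by simp⟩ ⟨neg_abs_le a, le_abs_self a⟩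
  simpa [h0] using this

/-- Taylor estimates for a curve whose first three derivatives are bounded near a point; the
odd and even parts of the increment are estimated separately. -/
lemma taylor_bounds {f0 f1 f2 f3 : ℝ → F} {l M C : ℝ}
    (h0 : ∀ s, HasDerivAt f0 (f1 s) s) (h1 : ∀ s, HasDerivAt f1 (f2 s) s)
    (h2 : ∀ s, HasDerivAt f2 (f3 s) s) (b1 : ∀ a, |a| ≤ M → ‖f1 (l + a)‖ ≤ C)
    (b2 : ∀ a, |a| ≤ M → ‖f2 (l + a)‖ ≤ C) (b3 : ∀ a, |a| ≤ M → ‖f3 (l + a)‖ ≤ C)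
    {a : ℝ} (ha : |a| ≤ M) :
    ‖f0 (l + a) - f0 l‖ ≤ C * |a| ∧
    ‖f0 (l + a) + f0 (l - a) - (2 : ℝ) • f0 l‖ ≤ 2 * C * |a| ^ 2 ∧
    ‖f0 (l + a) - f0 (l - a) - (2 * a) • f1 l‖ ≤ 2 * C * |a| ^ 3 ∧
    ‖f0 (l + a) - f0 l - a • f1 l‖ ≤ C * |a| ^ 2 := by
  have hp : ∀ {g g' : ℝ → F}, (∀ s, HasDerivAt g (g' s) s) → ∀ s,
      HasDerivAt (fun s => g (l + s)) (g' (l + s)) s := fun hg s =>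
    (hg (l + s)).comp_const_add l s
  have hm : ∀ {g g' : ℝ → F}, (∀ s, HasDerivAt g (g' s) s) → ∀ s,
      HasDerivAt (fun s => g (l - s)) (-g' (l - s)) s := fun hg s =>
    (hg (l - s)).comp_const_sub l s
  -- first order increments
  have e1 : ∀ {g g' : ℝ → F}, (∀ s, HasDerivAt g (g' s) s) →
      (∀ a, |a| ≤ M → ‖g' (l + a)‖ ≤ C) → ∀ a, |a| ≤ M → ‖g (l + a) - g l‖ ≤ C * |a| := by
    intro g g' hg hb a ha
    exact norm_le_of_hasDerivAt (h := fun s => g (l + s) - g l) (by simp)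
      (fun s _ => (hp hg s).sub_const _) (fun s hs => hb s (hs.trans ha))
  have e2 : ∀ {g g' g'' : ℝ → F}, (∀ s, HasDerivAt g (g' s) s) → (∀ s, HasDerivAt g' (g'' s) s) →
      (∀ a, |a| ≤ M → ‖g'' (l + a)‖ ≤ C) → ∀ a, |a| ≤ M →
      ‖g (l + a) + g (l - a) - (2 : ℝ) • g l‖ ≤ 2 * C * |a| ^ 2 := by
    intro g g' g'' hg hg' hb a ha
    have := norm_le_of_hasDerivAt (h := fun s => g (l + s) + g (l - s) - (2 : ℝ) • g l)
      (B := 2 * C * |a|) (a := a) (by simp [two_smul])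
      (fun s _ => ((hp hg s).add (hm hg s)).sub_const _) (fun s hs => by
        have k1 := e1 hg' hb s (hs.trans ha)
        have k2 := e1 hg' hb (-s) (by rw [abs_neg]; exact hs.trans ha)
        rw [abs_neg, ← sub_eq_add_neg] at k2
        have hC : 0 ≤ C := (norm_nonneg _).trans (hb a ha)
        calc ‖g' (l + s) + -g' (l - s)‖ = ‖(g' (l + s) - g' l) - (g' (l - s) - g' l)‖ := by
              congr 1; abel
          _ ≤ C * |s| + C * |s| := (norm_sub_le _ _).trans (add_le_add k1 k2)
          _ ≤ 2 * C * |a| := by nlinarith)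
    calc _ ≤ _ := this
      _ = _ := by ring
  refine ⟨e1 h0 b1 a ha, e2 h0 h1 b2 a ha, ?_, ?_⟩
  · have := norm_le_of_hasDerivAt
      (h := fun s => f0 (l + s) - f0 (l - s) - (2 * s) • f1 l)
      (h' := fun s => f1 (l + s) - -f1 (l - s) - (2 : ℝ) • f1 l)
      (B := 2 * C * |a| ^ 2) (a := a) (by simp)
      (fun s _ => by
        have k : HasDerivAt (fun s : ℝ => (2 * s) • f1 l) ((2 : ℝ) • f1 l) s := by
          simpa using ((hasDerivAt_id s).const_mul (2 : ℝ)).smul_const (f1 l)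
        exact ((hp h0 s).sub (hm h0 s)).sub k) (fun s hs => by
        rw [sub_neg_eq_add]
        have hC : 0 ≤ C := (norm_nonneg _).trans (b1 a ha)
        refine (e2 h1 h2 b3 s (hs.trans ha)).trans ?_
        gcongr)
    calc _ ≤ _ := this
      _ = _ := by ring
  · have := norm_le_of_hasDerivAt
      (h := fun s => f0 (l + s) - f0 l - s • f1 l) (h' := fun s => f1 (l + s) - f1 l)
      (B := C * |a|) (a := a) (by simp)
      (fun s _ => by
        have k : HasDerivAt (fun s : ℝ => s • f1 l) (f1 l) s := by
          simpa using (hasDerivAt_id s).smul_const (f1 l)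
        exact ((hp h0 s).sub_const _).sub k) (fun s hs => by
        have hC : 0 ≤ C := (norm_nonneg _).trans (b1 a ha)
        refine (e1 h1 b2 s (hs.trans ha)).trans ?_
        gcongr)
    calc _ ≤ _ := this
      _ = _ := by ring

lemma exists_uniform_bound (hO : IsOpen O) (hf : ContDiffOn ℝ ∞ f (O ×ˢ univ)) {p : P}
    (hp : p ∈ O) (l M : ℝ) :
    ∃ C, ∀ᶠ q in 𝓝 (p, l), ∀ a, |a| ≤ M → ‖f (q.1, q.2 + a)‖ ≤ C := by
  have hc : ∀ a : ℝ, ContinuousAt (fun z : (P × ℝ) × ℝ => f (z.1.1, z.1.2 + z.2)) ((p, l), a) :=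
    fun a => ContinuousAt.comp (g := f) (f := fun z : (P × ℝ) × ℝ => (z.1.1, z.1.2 + z.2))
      (continuousAt_family hO hf hp _) (by fun_prop)
  have hc' : ContinuousOn (fun a => f (p, l + a)) (Icc (-M) M) := fun a _ =>
    (ContinuousAt.comp (f := fun a : ℝ => (p, l + a)) (g := f)
      (continuousAt_family hO hf hp (l + a)) (by fun_prop)).continuousWithinAt
  obtain ⟨C, hC⟩ := isCompact_Icc.exists_bound_of_continuousOn hc'
  refine ⟨C + 1, ?_⟩
  have := (isCompact_Icc (a := -M) (b := M)).eventually_forall_of_forall_eventually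
    (x₀ := (p, l)) (P := fun q a => ‖f (q.1, q.2 + a)‖ < C + 1) (fun a ha =>
      (hc a).norm.eventually_lt_const (by have := hC a ha; dsimp only; linarith))
  filter_upwards [this] with q hq a ha
  exact (hq a (abs_le.1 ha)).le

/-- Taylor estimates in the angle, uniform in a neighbourhood of a parameter. -/
lemma exists_uniform_taylor (hO : IsOpen O) (hf : ContDiffOn ℝ ∞ f (O ×ˢ univ)) {p : P}
    (hp : p ∈ O) (l M : ℝ) :
    ∃ C, 0 ≤ C ∧ ∀ᶠ q : P × ℝ in 𝓝 (p, l), ∀ a, |a| ≤ M →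
      ‖f (q.1, q.2 + a)‖ ≤ C ∧ ‖angleDeriv f q‖ ≤ C ∧
      ‖f (q.1, q.2 + a) - f q‖ ≤ C * |a| ∧
      ‖f (q.1, q.2 + a) + f (q.1, q.2 - a) - (2 : ℝ) • f q‖ ≤ C * |a| ^ 2 ∧
      ‖f (q.1, q.2 + a) - f (q.1, q.2 - a) - (2 * a) • angleDeriv f q‖ ≤ C * |a| ^ 3 ∧
      ‖f (q.1, q.2 + a) - f q - a • angleDeriv f q‖ ≤ C * |a| ^ 2 := by
  have hf1 := contDiffOn_angleDeriv hO hf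
  have hf2 := contDiffOn_angleDeriv hO hf1
  have hf3 := contDiffOn_angleDeriv hO hf2
  obtain ⟨C0, h0⟩ := exists_uniform_bound hO hf hp l M
  obtain ⟨C1, h1⟩ := exists_uniform_bound hO hf1 hp l M
  obtain ⟨C2, h2⟩ := exists_uniform_bound hO hf2 hp l M
  obtain ⟨C3, h3⟩ := exists_uniform_bound hO hf3 hp l M
  set C := max (max C0 C1) (max C2 C3)
  have l0 : C0 ≤ C := (le_max_left _ _).trans (le_max_left _ _)
  have l1 : C1 ≤ C := (le_max_right _ _).trans (le_max_left _ _)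
  have l2 : C2 ≤ C := (le_max_left _ _).trans (le_max_right _ _)
  have l3 : C3 ≤ C := (le_max_right _ _).trans (le_max_right _ _)
  refine ⟨2 * |C|, by positivity, ?_⟩
  have hq : ∀ᶠ q : P × ℝ in 𝓝 (p, l), q.1 ∈ O :=
    continuousAt_fst.eventually (hO.mem_nhds hp)
  filter_upwards [h0, h1, h2, h3, hq] with q k0 k1 k2 k3 hq a ha
  obtain ⟨t1, t2, t3, t4⟩ := taylor_bounds (f0 := fun s => f (q.1, s))
    (f1 := fun s => angleDeriv f (q.1, s)) (f2 := fun s => angleDeriv (angleDeriv f) (q.1, s))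
    (f3 := fun s => angleDeriv (angleDeriv (angleDeriv f)) (q.1, s)) (l := q.2) (M := M) (C := C)
    (fun s => hasDerivAt_angle hO hf hq s) (fun s => hasDerivAt_angle hO hf1 hq s)
    (fun s => hasDerivAt_angle hO hf2 hq s) (fun a ha => (k1 a ha).trans l1)
    (fun a ha => (k2 a ha).trans l2) (fun a ha => (k3 a ha).trans l3) ha
  have hM : |(0 : ℝ)| ≤ M := by rw [abs_zero]; exact (abs_nonneg a).trans ha
  have hC2 : C ≤ 2 * |C| := by
    have := le_abs_self C; have := abs_nonneg C; linarith
  have hC1 : 2 * C ≤ 2 * |C| := by have := le_abs_self C; linarith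
  have k1' := k1 0 hM
  rw [add_zero] at k1'
  refine ⟨(k0 a ha).trans (l0.trans hC2), k1'.trans (l1.trans hC2), t1.trans ?_, t2.trans ?_,
    t3.trans ?_, t4.trans ?_⟩ <;> gcongr

end Family

/-! ### The symmetrized singular kernel -/

lemma abs_inv_cube_sub_le {m a b : ℝ} (hm : 0 < m) (ha : m ≤ a) (hb : m ≤ b) :
    |(b ^ 3)⁻¹ - (a ^ 3)⁻¹| ≤ |a ^ 2 - b ^ 2| * (2 / m ^ 5) := by
  have ha0 : 0 < a := hm.trans_le ha
  have hb0 : 0 < b := hm.trans_le hb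
  have h1 : (b ^ 3)⁻¹ - (a ^ 3)⁻¹ =
      (a ^ 2 - b ^ 2) * ((a ^ 2 + a * b + b ^ 2) / ((a + b) * (a ^ 3 * b ^ 3))) := by
    field_simp; ring
  rw [h1, abs_mul]
  refine mul_le_mul_of_nonneg_left ?_ (abs_nonneg _)
  rw [abs_of_nonneg (by positivity)]
  have h2 : (a ^ 2 + a * b + b ^ 2) / ((a + b) * (a ^ 3 * b ^ 3)) ≤
      1 / (a ^ 2 * b ^ 3) + 1 / (a ^ 3 * b ^ 2) := by
    have : 1 / (a ^ 2 * b ^ 3) + 1 / (a ^ 3 * b ^ 2) =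
        (a + b) ^ 2 / ((a + b) * (a ^ 3 * b ^ 3)) := by
      field_simp
    rw [this]
    gcongr
    nlinarith [mul_pos ha0 hb0]
  have h3 : 1 / (a ^ 2 * b ^ 3) ≤ 1 / m ^ 5 := by
    have : m ^ 5 = m ^ 2 * m ^ 3 := by ring
    rw [this]; gcongr
  have h4 : 1 / (a ^ 3 * b ^ 2) ≤ 1 / m ^ 5 := by
    have : m ^ 5 = m ^ 3 * m ^ 2 := by ring
    rw [this]; gcongr
  calc _ ≤ _ := h2
    _ ≤ 1 / m ^ 5 + 1 / m ^ 5 := add_le_add h3 h4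
    _ = 2 / m ^ 5 := by ring

section Kernel

variable {E : Type*} [NormedAddCommGroup E] [InnerProductSpace ℝ E]

/-- The kernel `⟨Δ, y⟩ / |Δ|³` has a singularity of order `r⁻²` where `Δ` is of order `r`. If `Δ₁`,
`Δ₂` and `y₁`, `y₂` are the values at opposite points at distance `r` from a base point at which
`⟨Δ₀, y₀⟩ = 0`, and `Δ₀` is orthogonal to the first order increment `A`, then the leading terms
cancel in the sum and a singularity of order `r⁻¹` is left. -/
lemma kernel_add_kernel_le {Δ₀ Δ₁ Δ₂ A y₀ y₁ y₂ : E} {r C c : ℝ} (hr : 0 < r) (hc : 0 < c)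
    (hA : inner ℝ A Δ₀ = 0) (hy : inner ℝ Δ₀ y₀ = 0)
    (nA : ‖A‖ ≤ C * r) (n0 : ‖Δ₀‖ ≤ C) (n1 : ‖Δ₁‖ ≤ C) (n2 : ‖Δ₂‖ ≤ C)
    (ny0 : ‖y₀‖ ≤ C) (ny2 : ‖y₂‖ ≤ C)
    (d1 : ‖Δ₁ - Δ₀‖ ≤ C * r) (d2 : ‖Δ₂ - Δ₀‖ ≤ C * r)
    (dy1 : ‖y₁ - y₀‖ ≤ C * r) (dy2 : ‖y₂ - y₀‖ ≤ C * r)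
    (s : ‖Δ₁ + Δ₂ - (2 : ℝ) • Δ₀‖ ≤ C * r ^ 2) (sy : ‖y₁ + y₂ - (2 : ℝ) • y₀‖ ≤ C * r ^ 2)
    (t : ‖Δ₁ - Δ₂ - (2 : ℝ) • A‖ ≤ C * r ^ 3)
    (l1 : c * r ≤ ‖Δ₁‖) (l2 : c * r ≤ ‖Δ₂‖) :
    |inner ℝ Δ₁ y₁ / ‖Δ₁‖ ^ 3 + inner ℝ Δ₂ y₂ / ‖Δ₂‖ ^ 3| ≤
      (6 * C ^ 2 / c ^ 3 + 32 * C ^ 4 / c ^ 5) * r⁻¹ := by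
  have hC : 0 ≤ C := (norm_nonneg _).trans n0
  have ip : ∀ {u v : E} {a b : ℝ}, ‖u‖ ≤ a → ‖v‖ ≤ b → |inner ℝ u v| ≤ a * b := fun hu hv =>
    (abs_real_inner_le_norm _ _).trans
      (mul_le_mul hu hv (norm_nonneg _) ((norm_nonneg _).trans hu))
  set S := Δ₁ + Δ₂ - (2 : ℝ) • Δ₀
  set T := y₁ + y₂ - (2 : ℝ) • y₀
  set U := Δ₁ - Δ₂ - (2 : ℝ) • A
  have eS : Δ₁ + Δ₂ = (2 : ℝ) • Δ₀ + S := by simp [S]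
  have eT : y₁ + y₂ = (2 : ℝ) • y₀ + T := by simp [T]
  have eU : Δ₁ - Δ₂ = (2 : ℝ) • A + U := by simp [U]
  have tri : ∀ {u v w : E} {b : ℝ}, ‖u - w‖ ≤ b → ‖v - w‖ ≤ b → ‖u - v‖ ≤ 2 * b := by
    intro u v w b h h'
    calc ‖u - v‖ = ‖(u - w) - (v - w)‖ := by congr 1; abel
      _ ≤ b + b := (norm_sub_le _ _).trans (add_le_add h h')
      _ = 2 * b := by ring
  have tri' : ∀ {u v w : E} {b : ℝ}, ‖u - w‖ ≤ b → ‖v - w‖ ≤ b →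
      ‖u + v - (2 : ℝ) • w‖ ≤ 2 * b := by
    intro u v w b h h'
    calc ‖u + v - (2 : ℝ) • w‖ = ‖(u - w) + (v - w)‖ := by congr 1; rw [two_smul]; abel
      _ ≤ b + b := (norm_add_le _ _).trans (add_le_add h h')
      _ = 2 * b := by ring
  -- the sum of the numerators is of second order
  have hN : |inner ℝ Δ₁ y₁ + inner ℝ Δ₂ y₂| ≤ 6 * C ^ 2 * r ^ 2 := by
    have e1 : inner ℝ Δ₁ y₁ + inner ℝ Δ₂ y₂ =
        (inner ℝ (Δ₁ + Δ₂) (y₁ + y₂) + inner ℝ (Δ₁ - Δ₂) (y₁ - y₂)) / 2 := by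
      simp only [inner_add_left, inner_add_right, inner_sub_left, inner_sub_right]; ring
    have e2 : inner ℝ (Δ₁ + Δ₂) (y₁ + y₂) =
        2 * inner ℝ Δ₀ T + 2 * inner ℝ S y₀ + inner ℝ S T := by
      rw [eS, eT]
      simp only [inner_add_left, inner_add_right, real_inner_smul_left, real_inner_smul_right, hy]
      ring
    have b1 := abs_le.1 (ip n0 sy)
    have b2 := abs_le.1 (ip s ny0)
    have b3 := abs_le.1 (ip (tri' d1 d2) (tri' dy1 dy2))
    have b4 := abs_le.1 (ip (tri d1 d2) (tri dy1 dy2))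
    rw [e1, e2, abs_le]
    constructor <;> linarith
  -- the squares of the denominators differ by a third order term
  have hD : |‖Δ₁‖ ^ 2 - ‖Δ₂‖ ^ 2| ≤ 8 * C ^ 2 * r ^ 3 := by
    have e1 : ‖Δ₁‖ ^ 2 - ‖Δ₂‖ ^ 2 = inner ℝ (Δ₁ - Δ₂) (Δ₁ + Δ₂) := by
      rw [← real_inner_self_eq_norm_sq, ← real_inner_self_eq_norm_sq]
      simp only [inner_add_right, inner_sub_left, real_inner_comm Δ₁ Δ₂]; ring
    have e2 : inner ℝ (Δ₁ - Δ₂) (Δ₁ + Δ₂) =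
        2 * inner ℝ A S + 2 * inner ℝ U Δ₀ + inner ℝ U S := by
      rw [eS, eU]
      simp only [inner_add_left, inner_add_right, real_inner_smul_left, real_inner_smul_right, hA]
      ring
    have nS : ‖S‖ ≤ 4 * C := by
      calc ‖S‖ ≤ ‖Δ₁‖ + ‖Δ₂‖ + ‖(2 : ℝ) • Δ₀‖ :=
            (norm_sub_le _ _).trans (by gcongr; exact norm_add_le _ _)
        _ ≤ 4 * C := by rw [norm_smul, Real.norm_two]; linarith
    have b1 := abs_le.1 (ip nA s)
    have b2 := abs_le.1 (ip t n0)
    have b3 := abs_le.1 (ip t nS)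
    rw [e1, e2, abs_le]
    constructor <;> linarith
  have hN2 : |inner ℝ Δ₂ y₂| ≤ 2 * C ^ 2 * r := by
    have e : inner ℝ Δ₂ y₂ = inner ℝ (Δ₂ - Δ₀) y₂ + inner ℝ Δ₀ (y₂ - y₀) := by
      simp only [inner_sub_left, inner_sub_right, hy]; ring
    have b1 := abs_le.1 (ip d2 ny2)
    have b2 := abs_le.1 (ip n0 dy2)
    rw [e, abs_le]
    constructor <;> linarith
  have hcr : 0 < c * r := mul_pos hc hr
  have hq := abs_inv_cube_sub_le hcr l1 l2
  have e : inner ℝ Δ₁ y₁ / ‖Δ₁‖ ^ 3 + inner ℝ Δ₂ y₂ / ‖Δ₂‖ ^ 3 =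
      (inner ℝ Δ₁ y₁ + inner ℝ Δ₂ y₂) * (‖Δ₁‖ ^ 3)⁻¹ +
        inner ℝ Δ₂ y₂ * ((‖Δ₂‖ ^ 3)⁻¹ - (‖Δ₁‖ ^ 3)⁻¹) := by
    simp only [div_eq_mul_inv]; ring
  have hi : |(‖Δ₁‖ ^ 3)⁻¹| ≤ ((c * r) ^ 3)⁻¹ := by
    rw [abs_of_nonneg (by positivity)]; gcongr
  rw [e]
  calc _ ≤ 6 * C ^ 2 * r ^ 2 * ((c * r) ^ 3)⁻¹ +
        2 * C ^ 2 * r * (8 * C ^ 2 * r ^ 3 * (2 / (c * r) ^ 5)) := by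
        refine (abs_add_le _ _).trans ?_
        rw [abs_mul, abs_mul]
        refine add_le_add (mul_le_mul hN hi (abs_nonneg _) (by positivity))
          (mul_le_mul hN2 (hq.trans ?_) (abs_nonneg _) (by positivity))
        gcongr
    _ = _ := by field_simp; ring

end Kernel

/-! ### Integrals over the torus -/

/-- The fundamental square of the torus of pairs of angles. In the norm of `ℝ × ℝ` it is a ball. -/
abbrev angleSquare : Set (ℝ × ℝ) := Icc (-Real.pi) Real.pi ×ˢ Icc (-Real.pi) Real.pi

lemma mem_angleSquare {v : ℝ × ℝ} : v ∈ angleSquare ↔ |v.1| ≤ Real.pi ∧ |v.2| ≤ Real.pi := by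
  simp only [mem_prod, mem_Icc, abs_le]

lemma isCompact_angleSquare : IsCompact angleSquare := isCompact_Icc.prod isCompact_Icc

lemma neg_mem_angleSquare {v : ℝ × ℝ} : -v ∈ angleSquare ↔ v ∈ angleSquare := by
  rw [mem_angleSquare, mem_angleSquare, Prod.fst_neg, Prod.snd_neg, abs_neg, abs_neg]

lemma integrableOn_norm_inv : IntegrableOn (fun v : ℝ × ℝ => ‖v‖⁻¹) angleSquare := by
  have h : Integrable (fun v : ℝ × ℝ => (Icc 0 Real.pi).indicator (fun y : ℝ => y⁻¹) ‖v‖) := by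
    rw [integrable_fun_norm_addHaar volume (f := (Icc 0 Real.pi).indicator (fun y : ℝ => y⁻¹))]
    have hi : Integrable ((Icc 0 Real.pi).indicator (fun _ : ℝ => (1 : ℝ))) := by
      rw [integrable_indicator_iff measurableSet_Icc]
      exact continuous_const.integrableOn_Icc
    refine hi.integrableOn.congr_fun (fun y hy => ?_) measurableSet_Ioi
    have hy : y ≠ 0 := ne_of_gt hy
    by_cases hm : y ∈ Icc 0 Real.pi <;> simp [hm, hy]
  refine (h.integrableOn (s := angleSquare)).congr_fun (fun v hv => ?_)
    (measurableSet_Icc.prod measurableSet_Icc)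
  have : ‖v‖ ∈ Icc 0 Real.pi := ⟨norm_nonneg _, by
    rw [mem_angleSquare] at hv
    exact max_le hv.1 hv.2⟩
  simp [this]

lemma setIntegral_angleSquare {f : ℝ × ℝ → ℝ} (hf : Continuous f) :
    ∫ v in angleSquare, f v = ∫ x in -Real.pi..Real.pi, ∫ y in -Real.pi..Real.pi, f (x, y) := by
  have hpi : -Real.pi ≤ Real.pi := by linarith [Real.pi_pos]
  rw [Measure.volume_eq_prod, setIntegral_prod f
    (hf.continuousOn.integrableOn_compact isCompact_angleSquare)]
  simp only [intervalIntegral.integral_of_le hpi, integral_Icc_eq_integral_Ioc]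

lemma intervalIntegral_shift {f : ℝ → ℝ} (hf : Function.Periodic f (2 * Real.pi)) (c : ℝ) :
    ∫ x in -Real.pi..Real.pi, f (c + x) = ∫ x in -Real.pi..Real.pi, f x := by
  rw [intervalIntegral.integral_comp_add_left]
  have := hf.intervalIntegral_add_eq (c + -Real.pi) (-Real.pi)
  convert! this using 2 <;> ring

/-- The integral of a periodic function over the torus does not change under translations. -/
lemma setIntegral_angleSquare_add {f : ℝ × ℝ → ℝ} (hf : Continuous f)
    (h1 : ∀ y, Function.Periodic (fun x => f (x, y)) (2 * Real.pi))
    (h2 : ∀ x, Function.Periodic (fun y => f (x, y)) (2 * Real.pi)) (c : ℝ × ℝ) :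
    ∫ v in angleSquare, f (c + v) = ∫ v in angleSquare, f v := by
  rw [setIntegral_angleSquare hf, setIntegral_angleSquare (by fun_prop)]
  simp only [Prod.add_def]
  have : ∀ x, ∫ y in -Real.pi..Real.pi, f (c.1 + x, c.2 + y) =
      ∫ y in -Real.pi..Real.pi, f (c.1 + x, y) := fun x => intervalIntegral_shift (h2 _) c.2
  simp only [this]
  exact intervalIntegral_shift (f := fun x => ∫ y in -Real.pi..Real.pi, f (x, y))
    (fun x => intervalIntegral.integral_congr fun y _ => h1 y x) c.1

lemma setIntegral_angleSquare_neg (f : ℝ × ℝ → ℝ) :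
    ∫ v in angleSquare, f (-v) = ∫ v in angleSquare, f v := by
  have := (Measure.measurePreserving_neg (volume : Measure (ℝ × ℝ))).setIntegral_preimage_emb
    (MeasurableEquiv.neg (ℝ × ℝ)).measurableEmbedding f angleSquare
  rw [← this]
  congr 2
  ext v
  exact neg_mem_angleSquare.symm

/-- The integral over the torus as the integral of the even part about any given point. -/
lemma setIntegral_angleSquare_symm {f : ℝ × ℝ → ℝ} (hf : Continuous f)
    (h1 : ∀ y, Function.Periodic (fun x => f (x, y)) (2 * Real.pi))
    (h2 : ∀ x, Function.Periodic (fun y => f (x, y)) (2 * Real.pi)) (c : ℝ × ℝ) :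
    ∫ v in angleSquare, f v = 1 / 2 * ∫ v in angleSquare, (f (c + v) + f (c - v)) := by
  have hi : ∀ g : ℝ × ℝ → ℝ, Continuous g → IntegrableOn g angleSquare := fun g hg =>
    hg.continuousOn.integrableOn_compact isCompact_angleSquare
  rw [integral_add (hi _ (by fun_prop)) (hi _ (by fun_prop)), setIntegral_angleSquare_add hf h1 h2]
  have := setIntegral_angleSquare_neg (fun v => f (c + v))
  simp only [← sub_eq_add_neg] at this
  rw [this, setIntegral_angleSquare_add hf h1 h2]
  ring

/-! ### Kepler's equation and the position on an elliptic orbit -/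

lemma one_sub_mul_cos_pos {e : ℝ} (he : |e| < 1) (u : ℝ) : 0 < 1 - e * Real.cos u := by
  have h : |e * Real.cos u| ≤ |e| := by
    rw [abs_mul]; exact mul_le_of_le_one_right (abs_nonneg _) (Real.abs_cos_le_one u)
  linarith [le_abs_self (e * Real.cos u)]

lemma hasDerivAt_kepler (e u : ℝ) :
    HasDerivAt (fun u : ℝ => u - e * Real.sin u) (1 - e * Real.cos u) u :=
  (hasDerivAt_id u).sub ((Real.hasDerivAt_sin u).const_mul e)

lemma strictMono_kepler {e : ℝ} (he : |e| < 1) :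
    StrictMono (fun u : ℝ => u - e * Real.sin u) :=
  strictMono_of_deriv_pos fun u => by
    rw [(hasDerivAt_kepler e u).deriv]; exact one_sub_mul_cos_pos he u

/-- Kepler's equation; negative eccentricities are allowed, so that the eccentric anomaly is
defined by it in a neighbourhood of `e = 0`. -/
lemma eccentricAnomaly_spec {e : ℝ} (he : |e| < 1) (l : ℝ) :
    eccentricAnomaly e l - e * Real.sin (eccentricAnomaly e l) = l := by
  refine Function.invFun_eq (f := fun u : ℝ => u - e * Real.sin u) ?_
  have hb : ∀ u, |e * Real.sin u| ≤ 1 := fun u => by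
    rw [abs_mul]; exact mul_le_one₀ he.le (abs_nonneg _) (Real.abs_sin_le_one u)
  have hc : Continuous (fun u : ℝ => u - e * Real.sin u) := by fun_prop
  obtain ⟨u, -, hu⟩ := intermediate_value_Icc (a := l - 1) (b := l + 1) (by linarith)
    hc.continuousOn (show l ∈ _ from
      ⟨by linarith [abs_le.1 (hb (l - 1))], by linarith [abs_le.1 (hb (l + 1))]⟩)
  exact ⟨u, hu⟩

lemma eq_eccentricAnomaly {e u l : ℝ} (he : |e| < 1) (h : u - e * Real.sin u = l) :
    u = eccentricAnomaly e l :=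
  (strictMono_kepler he).injective (h.trans (eccentricAnomaly_spec he l).symm)

lemma eccentricAnomaly_add_two_pi {e : ℝ} (he : |e| < 1) (l : ℝ) :
    eccentricAnomaly e (l + 2 * Real.pi) = eccentricAnomaly e l + 2 * Real.pi := by
  refine (eq_eccentricAnomaly he ?_).symm
  rw [Real.sin_add_two_pi]
  linarith [eccentricAnomaly_spec he l]

lemma contDiffAt_eccentricAnomaly {e : ℝ} (he : |e| < 1) (l : ℝ) :
    ContDiffAt ℝ ∞ (fun q : ℝ × ℝ => eccentricAnomaly q.1 q.2) (e, l) := by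
  set u := eccentricAnomaly e l with hu
  let Φ : (ℝ × ℝ) × ℝ → ℝ := fun x => x.2 - x.1.1 * Real.sin x.2 - x.1.2
  have hΦ : ContDiff ℝ ∞ Φ := by fun_prop
  have hd : HasDerivAt (fun s => Φ ((e, l), s)) (1 - e * Real.cos u) u :=
    (hasDerivAt_kepler e u).sub_const l
  have hd' : HasDerivAt (fun s => Φ ((e, l), s)) (fderiv ℝ Φ ((e, l), u) (0, 1)) u :=
    ((hΦ.differentiable (by simp)) ((e, l), u)).hasFDerivAt.comp_hasDerivAt u
      ((hasDerivAt_const u (e, l)).prodMk (hasDerivAt_id u))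
  obtain ⟨g, hg, -, hg0, -⟩ := exists_implicit_function (n := ∞) (by simp) (Φ := Φ) (p := (e, l))
    (q := u) hΦ.contDiffAt (by simp only [Φ]; linarith [eccentricAnomaly_spec he l]) (by
      intro w hw
      have : ((0 : ℝ × ℝ), w) = w • ((0 : ℝ × ℝ), (1 : ℝ)) := by simp
      rw [this, map_smul, ← hd.unique hd', smul_eq_mul] at hw
      exact (mul_eq_zero.1 hw).resolve_right (one_sub_mul_cos_pos he u).ne')
  refine hg.congr_of_eventuallyEq ?_
  have he' : ∀ᶠ q : ℝ × ℝ in 𝓝 (e, l), |q.1| < 1 :=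
    (continuousAt_fst.abs).eventually_lt_const he
  filter_upwards [hg0, he'] with q hq hq'
  exact (eq_eccentricAnomaly hq' (by simp only [Φ] at hq; linarith)).symm

/-- The position on an orbit as a function of the Keplerian elements `(a, e, I, ω, Ω)` and of the
mean anomaly. -/
def orbitMap (q : (ℝ × ℝ × ℝ × ℝ × ℝ) × ℝ) : Space :=
  keplerPosition q.1.1 q.1.2.1 q.1.2.2.1 q.1.2.2.2.1 q.1.2.2.2.2 q.2

/-- The Keplerian elements with `|e| < 1`: an open set on which `orbitMap` is smooth. -/
def smoothElements : Set (ℝ × ℝ × ℝ × ℝ × ℝ) := {p | |p.2.1| < 1}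

lemma isOpen_smoothElements : IsOpen smoothElements :=
  isOpen_lt (by fun_prop) continuous_const

/-- The unit vector from the focus to the perihelion. -/
def perihelionDir (i w Ω : ℝ) : Space :=
  !₂[Real.cos w * Real.cos Ω - Real.sin w * Real.sin Ω * Real.cos i,
     Real.cos w * Real.sin Ω + Real.sin w * Real.cos Ω * Real.cos i,
     Real.sin w * Real.sin i]

/-- The unit vector of the orbital plane orthogonal to the direction of the perihelion. -/
def transverseDir (i w Ω : ℝ) : Space :=
  !₂[-(Real.sin w * Real.cos Ω) - Real.cos w * Real.sin Ω * Real.cos i,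
     -(Real.sin w * Real.sin Ω) + Real.cos w * Real.cos Ω * Real.cos i,
     Real.cos w * Real.sin i]

lemma keplerPosition_eq (a e i w Ω l : ℝ) : keplerPosition a e i w Ω l =
    (a * (Real.cos (eccentricAnomaly e l) - e)) • perihelionDir i w Ω +
      (a * Real.sqrt (1 - e ^ 2) * Real.sin (eccentricAnomaly e l)) • transverseDir i w Ω := rfl

lemma inner_perihelionDir_self (i w Ω : ℝ) :
    inner ℝ (perihelionDir i w Ω) (perihelionDir i w Ω) = 1 := by
  simp only [inner_eq_sum, perihelionDir, Matrix.cons_val]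
  linear_combination (Real.cos w ^ 2 + Real.sin w ^ 2 * Real.cos i ^ 2) *
    Real.sin_sq_add_cos_sq Ω + Real.sin w ^ 2 * Real.sin_sq_add_cos_sq i +
    Real.sin_sq_add_cos_sq w

lemma inner_transverseDir_self (i w Ω : ℝ) :
    inner ℝ (transverseDir i w Ω) (transverseDir i w Ω) = 1 := by
  simp only [inner_eq_sum, transverseDir, Matrix.cons_val]
  linear_combination (Real.sin w ^ 2 + Real.cos w ^ 2 * Real.cos i ^ 2) *
    Real.sin_sq_add_cos_sq Ω + Real.cos w ^ 2 * Real.sin_sq_add_cos_sq i +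
    Real.sin_sq_add_cos_sq w

lemma inner_perihelionDir_transverseDir (i w Ω : ℝ) :
    inner ℝ (perihelionDir i w Ω) (transverseDir i w Ω) = 0 := by
  simp only [inner_eq_sum, perihelionDir, transverseDir, Matrix.cons_val]
  linear_combination Real.sin w * Real.cos w * ((Real.cos i ^ 2 - 1) *
    Real.sin_sq_add_cos_sq Ω + Real.sin_sq_add_cos_sq i)

lemma inner_keplerPosition_perihelionDir (a e i w Ω l : ℝ) :
    inner ℝ (keplerPosition a e i w Ω l) (perihelionDir i w Ω) =
      a * (Real.cos (eccentricAnomaly e l) - e) := by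
  rw [keplerPosition_eq, inner_add_left, real_inner_smul_left, real_inner_smul_left,
    inner_perihelionDir_self, real_inner_comm, inner_perihelionDir_transverseDir]
  ring

lemma inner_keplerPosition_transverseDir (a e i w Ω l : ℝ) :
    inner ℝ (keplerPosition a e i w Ω l) (transverseDir i w Ω) =
      a * Real.sqrt (1 - e ^ 2) * Real.sin (eccentricAnomaly e l) := by
  rw [keplerPosition_eq, inner_add_left, real_inner_smul_left, real_inner_smul_left,
    inner_transverseDir_self, inner_perihelionDir_transverseDir]
  ring

lemma sqrt_one_sub_sq_pos {e : ℝ} (he : |e| < 1) : 0 < Real.sqrt (1 - e ^ 2) := by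
  have := (sq_lt_one_iff_abs_lt_one e).2 he
  exact Real.sqrt_pos.2 (by linarith)

/-- An elliptic orbit does not pass through its focus. -/
lemma orbitMap_ne_zero {p : ℝ × ℝ × ℝ × ℝ × ℝ} (ha : 0 < p.1) (he : p ∈ smoothElements) (l : ℝ) :
    orbitMap (p, l) ≠ 0 := by
  obtain ⟨a, e, i, w, Ω⟩ := p
  intro h
  have he : |e| < 1 := he
  have h1 := inner_keplerPosition_perihelionDir a e i w Ω l
  have h2 := inner_keplerPosition_transverseDir a e i w Ω l
  change keplerPosition a e i w Ω l = 0 at h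
  rw [h, inner_zero_left] at h1 h2
  set u := eccentricAnomaly e l
  have hc : Real.cos u = e := by
    have := (mul_eq_zero.1 h1.symm).resolve_left ha.ne'
    linarith
  have hs : Real.sin u = 0 :=
    (mul_eq_zero.1 h2.symm).resolve_left (mul_pos ha (sqrt_one_sub_sq_pos he)).ne'
  have := Real.sin_sq_add_cos_sq u
  rw [hs, hc] at this
  have := (sq_lt_one_iff_abs_lt_one e).2 he
  linarith

lemma orbitMap_add_two_pi {p : ℝ × ℝ × ℝ × ℝ × ℝ} (he : p ∈ smoothElements) (l : ℝ) :
    orbitMap (p, l + 2 * Real.pi) = orbitMap (p, l) := by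
  simp only [orbitMap, keplerPosition_eq, eccentricAnomaly_add_two_pi he, Real.cos_add_two_pi,
    Real.sin_add_two_pi]

/-- Mean anomalies which differ by at most half a revolution give different points of the orbit,
unless they are equal. -/
lemma eq_zero_of_orbitMap_eq {p : ℝ × ℝ × ℝ × ℝ × ℝ} (ha : 0 < p.1) (he : p ∈ smoothElements)
    {l x : ℝ} (hx : |x| ≤ Real.pi) (h : orbitMap (p, l + x) = orbitMap (p, l)) : x = 0 := by
  obtain ⟨a, e, i, w, Ω⟩ := p
  have he : |e| < 1 := he
  change keplerPosition a e i w Ω (l + x) = keplerPosition a e i w Ω l at h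
  have h1 := inner_keplerPosition_perihelionDir a e i w Ω (l + x)
  have h2 := inner_keplerPosition_transverseDir a e i w Ω (l + x)
  rw [h, inner_keplerPosition_perihelionDir] at h1
  rw [h, inner_keplerPosition_transverseDir] at h2
  have k1 := eccentricAnomaly_spec he l
  have k2 := eccentricAnomaly_spec he (l + x)
  set u := eccentricAnomaly e l
  set u' := eccentricAnomaly e (l + x)
  have hc : Real.cos u = Real.cos u' := by
    have := mul_left_cancel₀ ha.ne' h1
    linarith
  have hs : Real.sin u = Real.sin u' :=
    mul_left_cancel₀ (mul_pos ha (sqrt_one_sub_sq_pos he)).ne' h2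
  have h3 : Real.cos (u' - u) = 1 := by
    rw [Real.cos_sub, hc, hs]; linarith [Real.sin_sq_add_cos_sq u']
  have hux : u' - u = x := by rw [hs] at k1; linarith
  rw [hux] at h3
  rw [abs_le] at hx
  exact (Real.cos_eq_one_iff_of_lt_of_lt (by linarith [Real.pi_pos])
    (by linarith [Real.pi_pos])).1 h3

lemma contDiffOn_orbitMap : ContDiffOn ℝ ∞ orbitMap (smoothElements ×ˢ univ) := by
  rintro ⟨⟨a, e, i, w, Ω⟩, l⟩ ⟨he, -⟩
  have he : |e| < 1 := he
  refine ContDiffAt.contDiffWithinAt ?_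
  have hu : ContDiffAt ℝ ∞ (fun q : (ℝ × ℝ × ℝ × ℝ × ℝ) × ℝ => eccentricAnomaly q.1.2.1 q.2)
      ((a, e, i, w, Ω), l) :=
    (contDiffAt_eccentricAnomaly he l).comp (f := fun q : (ℝ × ℝ × ℝ × ℝ × ℝ) × ℝ =>
      (q.1.2.1, q.2)) ((a, e, i, w, Ω), l) (by fun_prop)
  have hs : ContDiffAt ℝ ∞ (fun q : (ℝ × ℝ × ℝ × ℝ × ℝ) × ℝ => Real.sqrt (1 - q.1.2.1 ^ 2))
      ((a, e, i, w, Ω), l) := by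
    refine ContDiffAt.sqrt (by fun_prop) ?_
    have := (sq_lt_one_iff_abs_lt_one e).2 he
    dsimp only; linarith
  have hP : ContDiff ℝ ∞ (fun q : (ℝ × ℝ × ℝ × ℝ × ℝ) × ℝ =>
      perihelionDir q.1.2.2.1 q.1.2.2.2.1 q.1.2.2.2.2) := by
    rw [contDiff_euclidean]
    intro j
    fin_cases j <;> simp [perihelionDir] <;> fun_prop
  have hQ : ContDiff ℝ ∞ (fun q : (ℝ × ℝ × ℝ × ℝ × ℝ) × ℝ =>
      transverseDir q.1.2.2.1 q.1.2.2.2.1 q.1.2.2.2.2) := by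
    rw [contDiff_euclidean]
    intro j
    fin_cases j <;> simp [transverseDir] <;> fun_prop
  have ha : ContDiffAt ℝ ∞ (fun q : (ℝ × ℝ × ℝ × ℝ × ℝ) × ℝ => q.1.1)
      ((a, e, i, w, Ω), l) := by fun_prop
  have h1 : ContDiffAt ℝ ∞ (fun q : (ℝ × ℝ × ℝ × ℝ × ℝ) × ℝ => q.1.2.1)
      ((a, e, i, w, Ω), l) := by fun_prop
  exact ((ha.mul (hu.cos.sub h1)).smul hP.contDiffAt).add
    (((ha.mul hs).mul hu.sin).smul hQ.contDiffAt)

/-! ### Delaunay's elements -/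

lemma delaunayDomain_subset : delaunayDomain ⊆ ellipticDomain :=
  fun _ h => ⟨h.1, h.2.1.le, h.2.2.le⟩

lemma keplerElements_mem {E : Elements} (hE : E ∈ ellipticDomain) (k : ℝ) :
    keplerElements k E ∈ smoothElements := by
  obtain ⟨h1, h2, -⟩ := hE
  have : 0 < E.2 0 / E.1 := div_pos h1 (h1.trans_le h2)
  change |Real.sqrt (1 - (E.2 0 / E.1) ^ 2)| < 1
  rw [abs_of_nonneg (Real.sqrt_nonneg _), Real.sqrt_lt' one_pos]
  nlinarith [pow_pos this 2]

lemma keplerElements_fst_pos {E : Elements} (hE : E ∈ ellipticDomain) {k : ℝ} (hk : 0 < k) :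
    0 < (keplerElements k E).1 :=
  div_pos (pow_pos (hE.1.trans_le hE.2.1) 2) (pow_pos hk 2)

/-- Delaunay's elements as functions of the Keplerian ones. -/
def delaunayElements (k : ℝ) (p : ℝ × ℝ × ℝ × ℝ × ℝ) : Elements :=
  (k * Real.sqrt p.1, ![k * Real.sqrt p.1 * Real.sqrt (1 - p.2.1 ^ 2),
    k * Real.sqrt p.1 * Real.sqrt (1 - p.2.1 ^ 2) * Real.cos p.2.2.1, p.2.2.2.1, p.2.2.2.2])

lemma continuous_delaunayElements (k : ℝ) : Continuous (delaunayElements k) := by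
  refine Continuous.prodMk (by fun_prop) (continuous_pi fun j => ?_)
  fin_cases j <;> simp <;> fun_prop

lemma delaunayElements_keplerElements {E : Elements} (hE : E ∈ ellipticDomain) {k : ℝ}
    (hk : 0 < k) : delaunayElements k (keplerElements k E) = E := by
  obtain ⟨h1, h2, h3⟩ := hE
  have hL : 0 < E.1 := h1.trans_le h2
  have e1 : k * Real.sqrt (semimajorAxis k E) = E.1 := by
    rw [semimajorAxis, Real.sqrt_div (by positivity), Real.sqrt_sq hL.le, Real.sqrt_sq hk.le]
    field_simp
  have hle : E.2 0 / E.1 ≤ 1 := (div_le_one hL).2 h2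
  have hpos : 0 ≤ E.2 0 / E.1 := by positivity
  have e2 : E.1 * Real.sqrt (1 - eccentricity E ^ 2) = E.2 0 := by
    rw [eccentricity, Real.sq_sqrt (by nlinarith), sub_sub_cancel, Real.sqrt_sq hpos]
    field_simp
  have e3 : E.2 0 * Real.cos (inclination E) = E.2 1 := by
    rw [abs_le] at h3
    rw [inclination, Real.cos_arccos]
    · field_simp
    · rw [le_div_iff₀ h1]; linarith
    · rw [div_le_one h1]; linarith
  refine Prod.ext e1 ?_
  funext j
  fin_cases j <;> simp [delaunayElements, keplerElements, e1, e2, e3]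

lemma contDiffAt_keplerElements {L : ℝ} {Y : Fin 4 → ℝ} (hY : (L, Y) ∈ delaunayDomain) (k : ℝ) :
    ContDiffAt ℝ ∞ (fun X : Fin 4 → ℝ => keplerElements k (L, X)) Y := by
  obtain ⟨h1, h2, h3⟩ := hY
  dsimp only at h1 h2 h3
  have hL : 0 < L := h1.trans h2
  have e0 : ContDiffAt ℝ ∞ (fun X : Fin 4 → ℝ => Real.sqrt (1 - (X 0 / L) ^ 2)) Y := by
    refine ContDiffAt.sqrt (by fun_prop) ?_
    have h4 : Y 0 / L < 1 := (div_lt_one hL).2 h2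
    have h5 : 0 < Y 0 / L := by positivity
    nlinarith
  have e1 : ContDiffAt ℝ ∞ (fun X : Fin 4 → ℝ => Real.arccos (X 1 / X 0)) Y := by
    have hd : ContDiffAt ℝ ∞ (fun X : Fin 4 → ℝ => X 1 / X 0) Y :=
      ContDiffAt.div (by fun_prop) (by fun_prop) h1.ne'
    rw [abs_lt] at h3
    refine (Real.contDiffAt_arccos ?_ ?_).comp Y hd
    · intro h; rw [div_eq_iff h1.ne'] at h; linarith
    · intro h; rw [div_eq_iff h1.ne'] at h; linarith
  have e2 : ContDiffAt ℝ ∞ (fun X : Fin 4 → ℝ => (X 2, X 3)) Y := by fun_prop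
  have e3 : ContDiffAt ℝ ∞ (fun _ : Fin 4 → ℝ => L ^ 2 / k ^ 2) Y := contDiffAt_const
  exact e3.prodMk (e0.prodMk (e1.prodMk e2))

/-! ### Averages depending on a parameter -/

lemma abs_fst_le_norm (v : ℝ × ℝ) : |v.1| ≤ ‖v‖ := norm_fst_le v

lemma abs_snd_le_norm (v : ℝ × ℝ) : |v.2| ≤ ‖v‖ := norm_snd_le v

lemma continuousOn_setIntegral_angleSquare {H : ℝ → ℝ × ℝ → ℝ} {J : Set ℝ}
    (hH : ∀ t ∈ J, ∀ v, ContinuousAt (fun z : ℝ × (ℝ × ℝ) => H z.1 z.2) (t, v))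
    (hJ : IsOpen J) : ContinuousOn (fun t => ∫ v in angleSquare, H t v) J := by
  intro t ht
  refine ContinuousAt.continuousWithinAt ?_
  have hc : ∀ s ∈ J, Continuous (H s) := fun s hs => continuous_iff_continuousAt.2 fun v =>
    ContinuousAt.comp (g := fun z : ℝ × (ℝ × ℝ) => H z.1 z.2) (f := fun v => (s, v))
      (hH s hs v) (by fun_prop)
  obtain ⟨C, hC⟩ := isCompact_angleSquare.exists_bound_of_continuousOn (hc t ht).continuousOn
  have hb := isCompact_angleSquare.eventually_forall_of_forall_eventually
    (x₀ := t) (P := fun s v => ‖H s v‖ < C + 1) (fun v hv =>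
      (hH t ht v).norm.eventually_lt_const (by have := hC v hv; dsimp only; linarith))
  refine continuousAt_of_dominated (bound := fun _ => C + 1) ?_ ?_ ?_ ?_
  · filter_upwards [hJ.mem_nhds ht] with s hs using (hc s hs).aestronglyMeasurable
  · filter_upwards [hb] with s hs
    exact (ae_restrict_iff' (measurableSet_Icc.prod measurableSet_Icc)).2
      (Eventually.of_forall fun v hv => (hs v hv).le)
  · exact continuous_const.continuousOn.integrableOn_compact isCompact_angleSquare
  · exact Eventually.of_forall fun v =>
      ContinuousAt.comp (g := fun z : ℝ × (ℝ × ℝ) => H z.1 z.2) (f := fun s => (s, v))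
        (hH t ht v) (by fun_prop)

section Core

variable {P E : Type*} [NormedAddCommGroup P] [NormedSpace ℝ P] [NormedAddCommGroup E]
  [InnerProductSpace ℝ E]

/-- The vector between the points of two curves of the family `K`. -/
def gap (K : P × ℝ → E) (p p' : P) (V : ℝ × ℝ) : E := K (p, V.1) - K (p', V.2)

/-- Up to sign, the derivative of `1 / |gap|` when the parameter of the first curve moves with
velocity `η`. -/
def singularKernel (K : P × ℝ → E) (p p' η : P) (V : ℝ × ℝ) : ℝ :=
  inner ℝ (gap K p p' V) (paramDeriv K (p, V.1) η) / ‖gap K p p' V‖ ^ 3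

variable {O : Set P} {K : P × ℝ → E}

lemma continuousAt_comp_family {F X : Type*} [NormedAddCommGroup F] [NormedSpace ℝ F]
    [TopologicalSpace X] {f : P × ℝ → F} (hO : IsOpen O) (hf : ContDiffOn ℝ ∞ f (O ×ˢ univ))
    {p : X → P} {l : X → ℝ} {x : X} (hp : ContinuousAt p x) (hl : ContinuousAt l x)
    (hx : p x ∈ O) : ContinuousAt (fun y => f (p y, l y)) x :=
  ContinuousAt.comp (g := f) (f := fun y => (p y, l y))
    (continuousAt_family hO hf hx (l x)) (hp.prodMk hl)

lemma continuous_gap (hO : IsOpen O) (hK : ContDiffOn ℝ ∞ K (O ×ˢ univ)) {p p' : P}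
    (hp : p ∈ O) (hp' : p' ∈ O) : Continuous (gap K p p') :=
  continuous_iff_continuousAt.2 fun _ =>
    (continuousAt_comp_family (p := fun _ : ℝ × ℝ => p) hO hK continuousAt_const
      continuousAt_fst hp).sub (continuousAt_comp_family (p := fun _ : ℝ × ℝ => p')
        hO hK continuousAt_const continuousAt_snd hp')

lemma continuous_inner_gap (hO : IsOpen O) (hK : ContDiffOn ℝ ∞ K (O ×ˢ univ)) {p p' : P}
    (hp : p ∈ O) (hp' : p' ∈ O) (η : P) :
    Continuous (fun V : ℝ × ℝ => inner ℝ (gap K p p' V) (paramDeriv K (p, V.1) η)) := by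
  refine (continuous_gap hO hK hp hp').inner (Continuous.clm_apply ?_ continuous_const)
  exact continuous_iff_continuousAt.2 fun V => continuousAt_comp_family
    (p := fun _ : ℝ × ℝ => p) hO (contDiffOn_paramDeriv hO hK)
    continuousAt_const continuousAt_fst hp

lemma measurable_singularKernel (hO : IsOpen O) (hK : ContDiffOn ℝ ∞ K (O ×ˢ univ)) {p p' : P}
    (hp : p ∈ O) (hp' : p' ∈ O) (η : P) : Measurable (singularKernel K p p' η) :=
  (continuous_inner_gap hO hK hp hp' η).measurable.div
    ((continuous_gap hO hK hp hp').norm.pow 3).measurable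

lemma exists_norm_smul_sub_smul_ge {u w : E} (h : ∀ a b : ℝ, a • u = b • w → a = 0 ∧ b = 0) :
    ∃ c > 0, ∀ v : ℝ × ℝ, c * ‖v‖ ≤ ‖v.1 • u - v.2 • w‖ := by
  let B : ℝ × ℝ →ₗ[ℝ] E :=
    (LinearMap.fst ℝ ℝ ℝ).smulRight u - (LinearMap.snd ℝ ℝ ℝ).smulRight w
  have hB : ∀ v, B v = v.1 • u - v.2 • w := fun v => by simp [B]
  obtain ⟨c, hc, hc'⟩ := B.exists_antilipschitzWith (by
    rw [LinearMap.ker_eq_bot']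
    intro v hv
    rw [hB, sub_eq_zero] at hv
    exact Prod.ext (h _ _ hv).1 (h _ _ hv).2)
  refine ⟨(c : ℝ)⁻¹, by positivity, fun v => ?_⟩
  have := hc'.le_mul_dist v 0
  rw [map_zero, dist_zero_right, dist_zero_right, hB] at this
  rwa [inv_mul_le_iff₀ (by exact_mod_cast hc)]

/-- The data of the averaging argument: two curves of the family `K`, moving with `t`, together
with a critical point `V t` of their distance, and a velocity `η t` of the parameter of the first
curve for which the critical value is stationary. At the time `tc` the two curves cross
transversally at `V tc` and have no other common point. -/
structure CrossingData (K : P × ℝ → E) (O : Set P) (J : Set ℝ) (tc : ℝ) (p p' η : ℝ → P)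
    (V : ℝ → ℝ × ℝ) : Prop where
  isOpen_dom : IsOpen O
  smooth : ContDiffOn ℝ ∞ K (O ×ˢ univ)
  isOpen_times : IsOpen J
  mem_times : tc ∈ J
  contP : ContinuousOn p J
  contP' : ContinuousOn p' J
  contEta : ContinuousOn η J
  contV : ContinuousOn V J
  memP : ∀ t ∈ J, p t ∈ O
  memP' : ∀ t ∈ J, p' t ∈ O
  crit₁ : ∀ t ∈ J, inner ℝ (gap K (p t) (p' t) (V t)) (angleDeriv K (p t, (V t).1)) = 0
  crit₂ : ∀ t ∈ J, inner ℝ (gap K (p t) (p' t) (V t)) (angleDeriv K (p' t, (V t).2)) = 0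
  stationary : ∀ t ∈ J, inner ℝ (gap K (p t) (p' t) (V t)) (paramDeriv K (p t, (V t).1) (η t)) = 0
  transversal : ∀ a b : ℝ, a • angleDeriv K (p tc, (V tc).1) = b • angleDeriv K (p' tc, (V tc).2) →
    a = 0 ∧ b = 0
  unique : ∀ v ∈ angleSquare, gap K (p tc) (p' tc) (V tc + v) = 0 → v = 0

namespace CrossingData

variable {J : Set ℝ} {tc : ℝ} {p p' η : ℝ → P} {V : ℝ → ℝ × ℝ}

lemma eventually_taylor {F : Type*} [NormedAddCommGroup F] [NormedSpace ℝ F] {f : P × ℝ → F}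
    (hO : IsOpen O) (hf : ContDiffOn ℝ ∞ f (O ×ˢ univ)) {p : ℝ → P} {l : ℝ → ℝ}
    (hp : ContinuousAt p tc) (hl : ContinuousAt l tc) (h : p tc ∈ O) :
    ∃ C, 0 ≤ C ∧ ∀ᶠ t in 𝓝 tc, ∀ a, |a| ≤ Real.pi →
      ‖f (p t, l t + a)‖ ≤ C ∧ ‖angleDeriv f (p t, l t)‖ ≤ C ∧
      ‖f (p t, l t + a) - f (p t, l t)‖ ≤ C * |a| ∧
      ‖f (p t, l t + a) + f (p t, l t - a) - (2 : ℝ) • f (p t, l t)‖ ≤ C * |a| ^ 2 ∧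
      ‖f (p t, l t + a) - f (p t, l t - a) - (2 * a) • angleDeriv f (p t, l t)‖ ≤ C * |a| ^ 3 ∧
      ‖f (p t, l t + a) - f (p t, l t) - a • angleDeriv f (p t, l t)‖ ≤ C * |a| ^ 2 := by
  obtain ⟨C, hC, hev⟩ := exists_uniform_taylor hO hf h (l tc) Real.pi
  exact ⟨C, hC, (hp.prodMk hl).eventually hev⟩

/-- Near the crossing time the distance of the two curves grows at least linearly away from
its critical point. -/
lemma exists_norm_gap_ge (D : CrossingData K O J tc p p' η V) :
    ∃ c > 0, ∀ᶠ t in 𝓝 tc, ∀ v ∈ angleSquare, c * ‖v‖ ≤ ‖gap K (p t) (p' t) (V t + v)‖ := by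
  have hJ := D.isOpen_times.mem_nhds D.mem_times
  have cp := D.contP.continuousAt hJ
  have cp' := D.contP'.continuousAt hJ
  have cV := D.contV.continuousAt hJ
  have c1 : ContinuousAt (fun t => (V t).1) tc := cV.fst
  have c2 : ContinuousAt (fun t => (V t).2) tc := cV.snd
  have mp := D.memP tc D.mem_times
  have mp' := D.memP' tc D.mem_times
  have hK1 := contDiffOn_angleDeriv D.isOpen_dom D.smooth
  obtain ⟨C, hC, hev⟩ := eventually_taylor D.isOpen_dom D.smooth cp c1 mp
  obtain ⟨C', hC', hev'⟩ := eventually_taylor D.isOpen_dom D.smooth cp' c2 mp'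
  obtain ⟨c, hc, hlin⟩ := exists_norm_smul_sub_smul_ge D.transversal
  set u : ℝ → E := fun t => angleDeriv K (p t, (V t).1)
  set w : ℝ → E := fun t => angleDeriv K (p' t, (V t).2)
  have cu : ContinuousAt u tc := continuousAt_comp_family D.isOpen_dom hK1 cp c1 mp
  have cw : ContinuousAt w tc := continuousAt_comp_family D.isOpen_dom hK1 cp' c2 mp'
  have eu : ∀ᶠ t in 𝓝 tc, ‖u t - u tc‖ < c / 4 := by
    have := Metric.continuousAt_iff'.1 cu (c / 4) (by positivity)
    simpa only [dist_eq_norm] using this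
  have ew : ∀ᶠ t in 𝓝 tc, ‖w t - w tc‖ < c / 4 := by
    have := Metric.continuousAt_iff'.1 cw (c / 4) (by positivity)
    simpa only [dist_eq_norm] using this
  -- inside this radius the linear part of the gap dominates the quadratic error
  set δ : ℝ := c / (4 * (C + C' + 1)) with hδ
  have hδ0 : 0 < δ := by positivity
  have inner_part : ∀ᶠ t in 𝓝 tc, ∀ v ∈ angleSquare, ‖v‖ ≤ δ →
      c / 4 * ‖v‖ ≤ ‖gap K (p t) (p' t) (V t + v)‖ := by
    filter_upwards [hev, hev', eu, ew, hJ] with t k k' ku kw htJ v hv hvδ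
    rw [mem_angleSquare] at hv
    obtain ⟨-, -, -, -, -, t1⟩ := k v.1 hv.1
    obtain ⟨-, -, -, -, -, t2⟩ := k' v.2 hv.2
    set A := v.1 • u t - v.2 • w t
    set Δ₀ := gap K (p t) (p' t) (V t) with hΔ₀
    have hr := norm_nonneg v
    have hA : c / 2 * ‖v‖ ≤ ‖A‖ := by
      have e : v.1 • u tc - v.2 • w tc = A - v.1 • (u t - u tc) + v.2 • (w t - w tc) := by
        simp only [A, smul_sub]; abel
      have := hlin v
      have n1 : ‖v.1 • (u t - u tc)‖ ≤ ‖v‖ * (c / 4) := by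
        rw [norm_smul]
        exact mul_le_mul (norm_fst_le v) ku.le (norm_nonneg _) hr
      have n2 : ‖v.2 • (w t - w tc)‖ ≤ ‖v‖ * (c / 4) := by
        rw [norm_smul]
        exact mul_le_mul (norm_snd_le v) kw.le (norm_nonneg _) hr
      have n3 : ‖v.1 • u tc - v.2 • w tc‖ ≤ ‖A‖ + ‖v‖ * (c / 4) + ‖v‖ * (c / 4) := by
        rw [e]
        exact (norm_add_le _ _).trans (add_le_add ((norm_sub_le _ _).trans (by gcongr)) n2)
      linarith
    have horth : inner ℝ Δ₀ A = 0 := by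
      simp only [A, inner_sub_right, real_inner_smul_right, u, w, hΔ₀, D.crit₁ t htJ,
        D.crit₂ t htJ]
      ring
    have hA' : ‖A‖ ≤ ‖Δ₀ + A‖ := by
      have := norm_add_sq_eq_norm_sq_add_norm_sq_real horth
      nlinarith [norm_nonneg (Δ₀ + A), norm_nonneg A, norm_nonneg Δ₀]
    have hrem : ‖gap K (p t) (p' t) (V t + v) - (Δ₀ + A)‖ ≤ (C + C') * ‖v‖ ^ 2 := by
      have e : gap K (p t) (p' t) (V t + v) - (Δ₀ + A) =
          (K (p t, (V t).1 + v.1) - K (p t, (V t).1) - v.1 • u t) -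
          (K (p' t, (V t).2 + v.2) - K (p' t, (V t).2) - v.2 • w t) := by
        simp only [gap, hΔ₀, A, Prod.fst_add, Prod.snd_add]; abel
      rw [e]
      refine (norm_sub_le _ _).trans ((add_le_add t1 t2).trans ?_)
      have := abs_fst_le_norm v
      have := abs_snd_le_norm v
      calc C * |v.1| ^ 2 + C' * |v.2| ^ 2 ≤ C * ‖v‖ ^ 2 + C' * ‖v‖ ^ 2 := by gcongr
        _ = _ := by ring
    have hsmall : (C + C') * ‖v‖ ^ 2 ≤ c / 4 * ‖v‖ := by
      have : (C + C' + 1) * ‖v‖ ≤ c / 4 := by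
        rw [hδ, le_div_iff₀ (by positivity)] at hvδ
        linarith
      nlinarith
    have := norm_sub_norm_le (Δ₀ + A) (gap K (p t) (p' t) (V t + v))
    rw [norm_sub_rev] at this
    linarith
  -- outside, the two curves have no common point at the crossing time
  have hcomp : IsCompact (angleSquare ∩ {v | δ ≤ ‖v‖}) :=
    isCompact_angleSquare.inter_right (isClosed_le continuous_const continuous_norm)
  have cg : ∀ v : ℝ × ℝ, ContinuousAt
      (fun z : ℝ × (ℝ × ℝ) => gap K (p z.1) (p' z.1) (V z.1 + z.2)) (tc, v) := by
    intro v
    have hfst : ContinuousAt (fun z : ℝ × (ℝ × ℝ) => z.1) (tc, v) := continuousAt_fst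
    refine (continuousAt_comp_family (p := fun z : ℝ × (ℝ × ℝ) => p z.1)
      (l := fun z => (V z.1).1 + z.2.1) D.isOpen_dom D.smooth ?_ ?_ mp).sub
      (continuousAt_comp_family (p := fun z : ℝ × (ℝ × ℝ) => p' z.1)
        (l := fun z => (V z.1).2 + z.2.2) D.isOpen_dom D.smooth ?_ ?_ mp')
    · exact (cp.comp (f := fun z : ℝ × (ℝ × ℝ) => z.1) hfst)
    · exact ((c1.comp (f := fun z : ℝ × (ℝ × ℝ) => z.1) hfst).add
        (continuous_fst.comp continuous_snd).continuousAt)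
    · exact (cp'.comp (f := fun z : ℝ × (ℝ × ℝ) => z.1) hfst)
    · exact ((c2.comp (f := fun z : ℝ × (ℝ × ℝ) => z.1) hfst).add
        (continuous_snd.comp continuous_snd).continuousAt)
  obtain ⟨m, hm, hm'⟩ := hcomp.exists_forall_le' (a := 0)
    (f := fun v => ‖gap K (p tc) (p' tc) (V tc + v)‖)
    (((continuous_gap D.isOpen_dom D.smooth mp mp').comp
      (continuous_const.add continuous_id)).norm.continuousOn) (by
      rintro v ⟨hv, hv'⟩
      refine norm_pos_iff.2 fun h0 => ?_
      rw [D.unique v hv h0, mem_ofPred_eq, norm_zero] at hv'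
      linarith)
  have outer_part := hcomp.eventually_forall_of_forall_eventually (x₀ := tc)
    (P := fun t v => m / 2 < ‖gap K (p t) (p' t) (V t + v)‖) (fun v hv =>
      (cg v).norm.eventually_const_lt (by have := hm' v hv; dsimp only at this ⊢; linarith))
  have hpi := Real.pi_pos
  refine ⟨min (c / 4) (m / (2 * Real.pi)), by positivity, ?_⟩
  filter_upwards [inner_part, outer_part] with t k1 k2 v hv
  rcases le_total ‖v‖ δ with h | h
  · exact (mul_le_mul_of_nonneg_right (min_le_left _ _) (norm_nonneg v)).trans (k1 v hv h)
  · have hvpi : ‖v‖ ≤ Real.pi := max_le (mem_angleSquare.1 hv).1 (mem_angleSquare.1 hv).2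
    calc _ ≤ m / (2 * Real.pi) * Real.pi :=
          mul_le_mul (min_le_right _ _) hvpi (norm_nonneg v) (by positivity)
      _ = m / 2 := by field_simp
      _ ≤ _ := (k2 v ⟨hv, h⟩).le

/-- The even part of the singular kernel about the critical point has an integrable singularity,
uniformly in time near the crossing. -/
lemma exists_symm_kernel_le (D : CrossingData K O J tc p p' η V) :
    ∃ B, ∀ᶠ t in 𝓝 tc, ∀ v ∈ angleSquare, v ≠ 0 →
      |singularKernel K (p t) (p' t) (η t) (V t + v) +
        singularKernel K (p t) (p' t) (η t) (V t - v)| ≤ B * ‖v‖⁻¹ := by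
  have hJ := D.isOpen_times.mem_nhds D.mem_times
  have cp := D.contP.continuousAt hJ
  have cp' := D.contP'.continuousAt hJ
  have cV := D.contV.continuousAt hJ
  have c1 : ContinuousAt (fun t => (V t).1) tc := cV.fst
  have c2 : ContinuousAt (fun t => (V t).2) tc := cV.snd
  have mp := D.memP tc D.mem_times
  have mp' := D.memP' tc D.mem_times
  obtain ⟨C, hC, hev⟩ := eventually_taylor D.isOpen_dom D.smooth cp c1 mp
  obtain ⟨C', hC', hev'⟩ := eventually_taylor D.isOpen_dom D.smooth cp' c2 mp'
  obtain ⟨Cy, hCy, hevy⟩ := eventually_taylor D.isOpen_dom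
    (contDiffOn_paramDeriv D.isOpen_dom D.smooth) cp c1 mp
  obtain ⟨c, hc, hlow⟩ := D.exists_norm_gap_ge
  have hη : ∀ᶠ t in 𝓝 tc, ‖η t‖ < ‖η tc‖ + 1 :=
    (D.contEta.continuousAt hJ).norm.eventually_lt_const (by linarith)
  set Ce := ‖η tc‖ + 1
  have hCe : 0 ≤ Ce := by positivity
  set B := C + C' + Cy * Ce
  have hCB : C + C' ≤ B := le_add_of_nonneg_right (by positivity)
  have hyB : Cy * Ce ≤ B := le_add_of_nonneg_left (by positivity)
  refine ⟨6 * B ^ 2 / c ^ 3 + 32 * B ^ 4 / c ^ 5, ?_⟩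
  filter_upwards [hev, hev', hevy, hlow, hη, hJ] with t k k' ky kl kη htJ v hv hv0
  have hv' := mem_angleSquare.1 hv
  have n1 : |-v.1| ≤ Real.pi := by rw [abs_neg]; exact hv'.1
  have n2 : |-v.2| ≤ Real.pi := by rw [abs_neg]; exact hv'.2
  have z : |(0 : ℝ)| ≤ Real.pi := by rw [abs_zero]; exact Real.pi_pos.le
  obtain ⟨a0, a1, a2, a3, a4, -⟩ := k v.1 hv'.1
  obtain ⟨b0, b1, b2, b3, b4, -⟩ := k' v.2 hv'.2
  obtain ⟨y0, -, y2, y3, -, -⟩ := ky v.1 hv'.1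
  obtain ⟨a0', -, a2', -⟩ := k (-v.1) n1
  obtain ⟨b0', -, b2', -⟩ := k' (-v.2) n2
  obtain ⟨y0', -, y2', -⟩ := ky (-v.1) n1
  have a00 := (k 0 z).1
  have b00 := (k' 0 z).1
  have y00 := (ky 0 z).1
  rw [add_zero] at a00 b00 y00
  rw [← sub_eq_add_neg] at a0' b0' y0' a2' b2' y2'
  rw [abs_neg] at a2' b2' y2'
  have hr : 0 < ‖v‖ := norm_pos_iff.2 hv0
  have r1 := abs_fst_le_norm v
  have r2 := abs_snd_le_norm v
  -- bounds for differences of the two curves, and for the velocity vector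
  have sub_le : ∀ {x x' : E} {n : ℕ}, ‖x‖ ≤ C * |v.1| ^ n → ‖x'‖ ≤ C' * |v.2| ^ n →
      ‖x - x'‖ ≤ B * ‖v‖ ^ n := by
    intro x x' n hx hx'
    calc ‖x - x'‖ ≤ C * |v.1| ^ n + C' * |v.2| ^ n := (norm_sub_le _ _).trans (add_le_add hx hx')
      _ ≤ C * ‖v‖ ^ n + C' * ‖v‖ ^ n := by gcongr
      _ = (C + C') * ‖v‖ ^ n := by ring
      _ ≤ B * ‖v‖ ^ n := by gcongr
  have y_le : ∀ {L : P →L[ℝ] E} {n : ℕ}, ‖L‖ ≤ Cy * |v.1| ^ n → ‖L (η t)‖ ≤ B * ‖v‖ ^ n := by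
    intro L n hL
    calc ‖L (η t)‖ ≤ ‖L‖ * ‖η t‖ := L.le_opNorm _
      _ ≤ (Cy * |v.1| ^ n) * Ce := mul_le_mul hL kη.le (norm_nonneg _) (by positivity)
      _ ≤ (Cy * ‖v‖ ^ n) * Ce := by gcongr
      _ = Cy * Ce * ‖v‖ ^ n := by ring
      _ ≤ B * ‖v‖ ^ n := by gcongr
  have sub0 : ∀ {x x' : E}, ‖x‖ ≤ C → ‖x'‖ ≤ C' → ‖x - x'‖ ≤ B := fun hx hx' => by
    simpa using sub_le (n := 0) (by simpa using hx) (by simpa using hx')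
  have ye0 : ∀ {L : P →L[ℝ] E}, ‖L‖ ≤ Cy → ‖L (η t)‖ ≤ B := fun hL => by
    simpa using y_le (n := 0) (by simpa using hL)
  set G := gap K (p t) (p' t)
  set Z : ℝ → P →L[ℝ] E := fun l => paramDeriv K (p t, l)
  refine kernel_add_kernel_le (Δ₀ := G (V t)) (Δ₁ := G (V t + v)) (Δ₂ := G (V t - v))
    (A := v.1 • angleDeriv K (p t, (V t).1) - v.2 • angleDeriv K (p' t, (V t).2))
    (y₀ := Z (V t).1 (η t)) (y₁ := Z (V t + v).1 (η t)) (y₂ := Z (V t - v).1 (η t))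
    hr hc ?_ (D.stationary t htJ) ?_ (sub0 a00 b00) (sub0 a0 b0) (sub0 a0' b0') (ye0 y00)
    (ye0 y0') ?_ ?_ ?_ ?_ ?_ ?_ ?_ (kl v hv) ?_
  · rw [real_inner_comm]
    simp only [inner_sub_right, real_inner_smul_right, G, D.crit₁ t htJ, D.crit₂ t htJ]
    ring
  · rw [← pow_one ‖v‖]
    refine sub_le ?_ ?_
    · rw [norm_smul, pow_one, mul_comm]; exact mul_le_mul_of_nonneg_right a1 (norm_nonneg _)
    · rw [norm_smul, pow_one, mul_comm]; exact mul_le_mul_of_nonneg_right b1 (norm_nonneg _)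
  · have e : G (V t + v) - G (V t) = (K (p t, (V t).1 + v.1) - K (p t, (V t).1)) -
        (K (p' t, (V t).2 + v.2) - K (p' t, (V t).2)) := by
      simp only [G, gap, Prod.fst_add, Prod.snd_add]; abel
    rw [e, ← pow_one ‖v‖]
    exact sub_le (by rwa [pow_one]) (by rwa [pow_one])
  · have e : G (V t - v) - G (V t) = (K (p t, (V t).1 - v.1) - K (p t, (V t).1)) -
        (K (p' t, (V t).2 - v.2) - K (p' t, (V t).2)) := by
      simp only [G, gap, Prod.fst_sub, Prod.snd_sub]; abel
    rw [e, ← pow_one ‖v‖]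
    exact sub_le (by rwa [pow_one]) (by rwa [pow_one])
  · rw [← _root_.sub_apply, ← pow_one ‖v‖]
    exact y_le (by rw [pow_one]; exact y2)
  · rw [← _root_.sub_apply, ← pow_one ‖v‖]
    exact y_le (by rw [pow_one]; exact y2')
  · have e : G (V t + v) + G (V t - v) - (2 : ℝ) • G (V t) =
        (K (p t, (V t).1 + v.1) + K (p t, (V t).1 - v.1) - (2 : ℝ) • K (p t, (V t).1)) -
        (K (p' t, (V t).2 + v.2) + K (p' t, (V t).2 - v.2) - (2 : ℝ) • K (p' t, (V t).2)) := by
      simp only [G, gap, Prod.fst_add, Prod.snd_add, Prod.fst_sub, Prod.snd_sub, smul_sub]; abel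
    rw [e]
    exact sub_le a3 b3
  · exact y_le (L := Z (V t + v).1 + Z (V t - v).1 - (2 : ℝ) • Z (V t).1) y3
  · have e : G (V t + v) - G (V t - v) - (2 : ℝ) •
          (v.1 • angleDeriv K (p t, (V t).1) - v.2 • angleDeriv K (p' t, (V t).2)) =
        (K (p t, (V t).1 + v.1) - K (p t, (V t).1 - v.1) -
          (2 * v.1) • angleDeriv K (p t, (V t).1)) -
        (K (p' t, (V t).2 + v.2) - K (p' t, (V t).2 - v.2) -
          (2 * v.2) • angleDeriv K (p' t, (V t).2)) := by
      simp only [G, gap, Prod.fst_add, Prod.snd_add, Prod.fst_sub, Prod.snd_sub, smul_sub,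
        smul_smul]; abel
    rw [e]
    exact sub_le a4 b4
  · have := kl (-v) (neg_mem_angleSquare.2 hv)
    rwa [norm_neg, ← sub_eq_add_neg] at this

/-- The integral of the even part of the singular kernel is continuous across the crossing. -/
theorem exists_continuousOn_integral (D : CrossingData K O J tc p p' η V) :
    ∃ N ∈ 𝓝 tc, ContinuousOn (fun t => ∫ v in angleSquare,
      (singularKernel K (p t) (p' t) (η t) (V t + v) +
        singularKernel K (p t) (p' t) (η t) (V t - v))) N := by
  obtain ⟨c, hc, hlow⟩ := D.exists_norm_gap_ge
  obtain ⟨B, hB⟩ := D.exists_symm_kernel_le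
  have hJ := D.isOpen_times.mem_nhds D.mem_times
  refine ⟨_, (hlow.and hB).and hJ, ?_⟩
  have hms : MeasurableSet angleSquare := measurableSet_Icc.prod measurableSet_Icc
  have hae : ∀ᵐ v : ℝ × ℝ ∂(volume.restrict angleSquare), v ∈ angleSquare ∧ v ≠ 0 :=
    (ae_restrict_mem hms).and (ae_restrict_of_ae (compl_mem_ae_iff.2 (measure_singleton 0)))
  refine continuousOn_of_dominated (bound := fun v => B * ‖v‖⁻¹) ?_ ?_
    (integrableOn_norm_inv.const_mul B) ?_
  · rintro t ⟨-, ht⟩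
    have hm := measurable_singularKernel D.isOpen_dom D.smooth (D.memP t ht) (D.memP' t ht) (η t)
    exact ((hm.comp (measurable_const.add measurable_id)).add
      (hm.comp (measurable_const.sub measurable_id))).aestronglyMeasurable
  · rintro t ⟨⟨-, ht⟩, -⟩
    filter_upwards [hae] with v hv
    exact ht v hv.1 hv.2
  · filter_upwards [hae] with v hv
    have key : ∀ w ∈ angleSquare, w ≠ 0 → ContinuousOn
        (fun t => singularKernel K (p t) (p' t) (η t) (V t + w))
        {t | ((∀ v ∈ angleSquare, c * ‖v‖ ≤ ‖gap K (p t) (p' t) (V t + v)‖) ∧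
          ∀ v ∈ angleSquare, v ≠ 0 → |singularKernel K (p t) (p' t) (η t) (V t + v) +
            singularKernel K (p t) (p' t) (η t) (V t - v)| ≤ B * ‖v‖⁻¹) ∧ t ∈ J} := by
      rintro w hw hw0 t ⟨⟨ht, -⟩, htJ⟩
      have hJt := D.isOpen_times.mem_nhds htJ
      have cV := D.contV.continuousAt hJt
      have l1 : ContinuousAt (fun t => (V t + w).1) t := cV.fst.add_const _
      have l2 : ContinuousAt (fun t => (V t + w).2) t := cV.snd.add_const _
      have cp := D.contP.continuousAt hJt
      have cp' := D.contP'.continuousAt hJt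
      have g : ContinuousAt (fun t => gap K (p t) (p' t) (V t + w)) t :=
        (continuousAt_comp_family D.isOpen_dom D.smooth cp l1 (D.memP t htJ)).sub
          (continuousAt_comp_family D.isOpen_dom D.smooth cp' l2 (D.memP' t htJ))
      have y : ContinuousAt (fun t => paramDeriv K (p t, (V t + w).1)) t :=
        continuousAt_comp_family D.isOpen_dom (contDiffOn_paramDeriv D.isOpen_dom D.smooth)
          cp l1 (D.memP t htJ)
      refine ContinuousAt.continuousWithinAt ((g.inner
        (y.clm_apply (D.contEta.continuousAt hJt))).div (g.norm.pow 3) ?_)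
      have : 0 < c * ‖w‖ := mul_pos hc (norm_pos_iff.2 hw0)
      exact (pow_pos (this.trans_le (ht w hw)) 3).ne'
    refine (key v hv.1 hv.2).add ?_
    simp only [sub_eq_add_neg]
    have := key (-v) (neg_mem_angleSquare.2 hv.1) (neg_ne_zero.2 hv.2)
    simpa only [sub_eq_add_neg] using this

end CrossingData

end Core

/-! ### Critical points of the distance of two curves -/

section Critical

variable {P E : Type*} [NormedAddCommGroup P] [NormedSpace ℝ P] [NormedAddCommGroup E]
  [InnerProductSpace ℝ E] {O : Set P} {K : P × ℝ → E} {p p' : P} {V : ℝ × ℝ}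

lemma hasFDerivAt_gap (hO : IsOpen O) (hK : ContDiffOn ℝ ∞ K (O ×ˢ univ)) (hp : p ∈ O)
    (hp' : p' ∈ O) (V : ℝ × ℝ) :
    HasFDerivAt (gap K p p')
      ((ContinuousLinearMap.fst ℝ ℝ ℝ).smulRight (angleDeriv K (p, V.1)) -
        (ContinuousLinearMap.snd ℝ ℝ ℝ).smulRight (angleDeriv K (p', V.2))) V := by
  have h1 := (hasDerivAt_angle hO hK hp V.1).hasFDerivAt.comp V
    (hasFDerivAt_fst (𝕜 := ℝ) (E := ℝ) (F := ℝ) (p := V))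
  have h2 := (hasDerivAt_angle hO hK hp' V.2).hasFDerivAt.comp V
    (hasFDerivAt_snd (𝕜 := ℝ) (E := ℝ) (F := ℝ) (p := V))
  refine (h1.sub h2).congr_fderiv ?_
  ext <;> simp

/-- At a critical point of the distance, the vector joining the curves is orthogonal to both. -/
lemma inner_gap_of_isLocalMin (hO : IsOpen O) (hK : ContDiffOn ℝ ∞ K (O ×ˢ univ)) (hp : p ∈ O)
    (hp' : p' ∈ O) (h : IsLocalMin (fun W => ‖gap K p p' W‖ ^ 2) V) :
    inner ℝ (gap K p p' V) (angleDeriv K (p, V.1)) = 0 ∧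
      inner ℝ (gap K p p' V) (angleDeriv K (p', V.2)) = 0 := by
  have h0 := h.hasFDerivAt_eq_zero (hasFDerivAt_gap hO hK hp hp' V).norm_sq
  have h1 := DFunLike.congr_fun h0 (1, 0)
  have h2 := DFunLike.congr_fun h0 (0, 1)
  simp at h1 h2
  exact ⟨h1, h2⟩

/-- At an intersection point of the curves the Hessian of the squared distance is twice the Gram
matrix of the tangent vectors; if it is non-degenerate, then these are linearly independent. -/
lemma transversal_of_nondegenerate (hO : IsOpen O) (hK : ContDiffOn ℝ ∞ K (O ×ˢ univ))
    (hp : p ∈ O) (hp' : p' ∈ O) (h0 : gap K p p' V = 0)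
    (hnd : ∀ w : ℝ × ℝ, fderiv ℝ (fderiv ℝ (fun W => ‖gap K p p' W‖ ^ 2)) V w = 0 → w = 0)
    (a b : ℝ) (h : a • angleDeriv K (p, V.1) = b • angleDeriv K (p', V.2)) : a = 0 ∧ b = 0 := by
  have hd := hasFDerivAt_gap hO hK hp hp'
  set G' : ℝ × ℝ → ℝ × ℝ →L[ℝ] E := fun W =>
    (ContinuousLinearMap.fst ℝ ℝ ℝ).smulRight (angleDeriv K (p, W.1)) -
      (ContinuousLinearMap.snd ℝ ℝ ℝ).smulRight (angleDeriv K (p', W.2)) with hG'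
  have hK1 := contDiffOn_angleDeriv hO hK
  have dG' : DifferentiableAt ℝ G' V := by
    have d1 : DifferentiableAt ℝ (fun W : ℝ × ℝ => angleDeriv K (p, W.1)) V :=
      (hasDerivAt_angle hO hK1 hp V.1).differentiableAt.comp V differentiableAt_fst
    have d2 : DifferentiableAt ℝ (fun W : ℝ × ℝ => angleDeriv K (p', W.2)) V :=
      (hasDerivAt_angle hO hK1 hp' V.2).differentiableAt.comp V differentiableAt_snd
    exact (((ContinuousLinearMap.smulRightL ℝ (ℝ × ℝ) E
      (ContinuousLinearMap.fst ℝ ℝ ℝ)).differentiableAt).comp V d1).sub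
      (((ContinuousLinearMap.smulRightL ℝ (ℝ × ℝ) E
      (ContinuousLinearMap.snd ℝ ℝ ℝ)).differentiableAt).comp V d2)
  have e1 : fderiv ℝ (fun W => ‖gap K p p' W‖ ^ 2) =
      fun W => (2 : ℝ) • (innerSL ℝ (gap K p p' W)).comp (G' W) := by
    funext W
    rw [(hd W).norm_sq.fderiv]
    ext <;> simp [G']
  have hs : HasFDerivAt (fun W => innerSL ℝ (gap K p p' W)) ((innerSL ℝ).comp (G' V)) V :=
    (innerSL ℝ).hasFDerivAt.comp V (hd V)
  have e2 := ((hs.clm_comp dG'.hasFDerivAt).const_smul (2 : ℝ)).fderiv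
  have hz : G' V (a, b) = 0 := by simp [G', h]
  have := hnd (a, b) (by
    rw [e1]
    change fderiv ℝ ((2 : ℝ) • fun W => (innerSL ℝ (gap K p p' W)).comp (G' W)) V (a, b) = 0
    rw [e2]
    ext <;> simp [h0, hz])
  exact ⟨congrArg Prod.fst this, congrArg Prod.snd this⟩

end Critical

/-! ### The signed distance of two curves near a crossing -/

section SignedDistance

variable {P : Type*} [NormedAddCommGroup P] [NormedSpace ℝ P] {O : Set P} {K : P × ℝ → Space}

/-- The common normal of two curves: the cross product of their tangent vectors. -/
def commonNormal (K : P × ℝ → Space) (p p' : P) (V : ℝ × ℝ) : Space :=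
  cross (angleDeriv K (p, V.1)) (angleDeriv K (p', V.2))

/-- The normalized common normal of two curves. -/
def unitNormal (K : P × ℝ → Space) (p p' : P) (V : ℝ × ℝ) : Space :=
  ‖commonNormal K p p' V‖⁻¹ • commonNormal K p p' V

lemma inner_unitNormal_self {p p' : P} {V : ℝ × ℝ} (h : commonNormal K p p' V ≠ 0) :
    inner ℝ (unitNormal K p p' V) (unitNormal K p p' V) = 1 := by
  have : ‖commonNormal K p p' V‖ ≠ 0 := norm_ne_zero_iff.2 h
  rw [unitNormal, real_inner_smul_left, real_inner_smul_right, real_inner_self_eq_norm_sq]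
  field_simp

lemma inner_unitNormal_left (K : P × ℝ → Space) (p p' : P) (V : ℝ × ℝ) :
    inner ℝ (unitNormal K p p' V) (angleDeriv K (p, V.1)) = 0 := by
  rw [unitNormal, real_inner_smul_left, commonNormal, inner_cross_left, mul_zero]

lemma inner_unitNormal_right (K : P × ℝ → Space) (p p' : P) (V : ℝ × ℝ) :
    inner ℝ (unitNormal K p p' V) (angleDeriv K (p', V.2)) = 0 := by
  rw [unitNormal, real_inner_smul_left, commonNormal, inner_cross_right, mul_zero]

/-- At a critical point of the distance, the vector joining the curves is a multiple of their
common normal. -/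
lemma eq_inner_smul_unitNormal {p p' : P} {V : ℝ × ℝ} (h : commonNormal K p p' V ≠ 0) {u : Space}
    (h1 : inner ℝ u (angleDeriv K (p, V.1)) = 0) (h2 : inner ℝ u (angleDeriv K (p', V.2)) = 0) :
    u = inner ℝ (unitNormal K p p' V) u • unitNormal K p p' V := by
  have hn : ‖commonNormal K p p' V‖ ≠ 0 := norm_ne_zero_iff.2 h
  have := norm_cross_sq_smul h1 h2
  rw [← commonNormal] at this
  rw [unitNormal, real_inner_smul_left, smul_smul]
  calc u = (‖commonNormal K p p' V‖ ^ 2)⁻¹ • (‖commonNormal K p p' V‖ ^ 2 • u) := by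
        rw [smul_smul, inv_mul_cancel₀ (pow_ne_zero 2 hn), one_smul]
    _ = _ := by
        rw [this, smul_smul]; congr 1; field_simp

lemma continuousAt_unitNormal {X : Type*} [TopologicalSpace X] {q q' : X → P} {V : X → ℝ × ℝ}
    {x : X} (hO : IsOpen O) (hK : ContDiffOn ℝ ∞ K (O ×ˢ univ)) (cq : ContinuousAt q x)
    (cq' : ContinuousAt q' x) (cV : ContinuousAt V x) (hq : q x ∈ O) (hq' : q' x ∈ O)
    (h : commonNormal K (q x) (q' x) (V x) ≠ 0) :
    ContinuousAt (fun y => unitNormal K (q y) (q' y) (V y)) x := by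
  have hK1 := contDiffOn_angleDeriv hO hK
  have hc : ContinuousAt (fun y => commonNormal K (q y) (q' y) (V y)) x :=
    continuous_cross.continuousAt.comp
      (f := fun y => (angleDeriv K (q y, (V y).1), angleDeriv K (q' y, (V y).2)))
      ((continuousAt_comp_family hO hK1 cq cV.fst hq).prodMk
        (continuousAt_comp_family hO hK1 cq' cV.snd hq'))
  exact (hc.norm.inv₀ (norm_ne_zero_iff.2 h)).smul hc

lemma contDiffAt_family {F X : Type*} [NormedAddCommGroup F] [NormedSpace ℝ F]
    [NormedAddCommGroup X] [NormedSpace ℝ X] {f : P × ℝ → F} (hO : IsOpen O)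
    (hf : ContDiffOn ℝ ∞ f (O ×ˢ univ)) {q : X → P} {l : X → ℝ} {x : X} (hq : ContDiffAt ℝ 1 q x)
    (hl : ContDiffAt ℝ 1 l x) (hx : q x ∈ O) : ContDiffAt ℝ 1 (fun y => f (q y, l y)) x :=
  ContDiffAt.comp (g := f) (f := fun y => (q y, l y)) x
    ((hf.contDiffAt ((hO.prod isOpen_univ).mem_nhds ⟨hx, mem_univ _⟩)).of_le (by simp))
    (hq.prodMk hl)

/-- Near a transversal crossing there is a `C¹` function `D` of the parameters of the two curves
whose value is the signed distance at the critical point of the distance. When only the first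
curve moves, its derivative is the normal component of the velocity, since neither the turning of
the unit normal nor the motion of the critical point contributes. -/
theorem exists_signed_distance [CompleteSpace P] (hO : IsOpen O)
    (hK : ContDiffOn ℝ ∞ K (O ×ˢ univ)) {p p' : P} (hp : p ∈ O) (hp' : p' ∈ O) {V : ℝ × ℝ}
    (h0 : gap K p p' V = 0)
    (htr : ∀ a b : ℝ, a • angleDeriv K (p, V.1) = b • angleDeriv K (p', V.2) → a = 0 ∧ b = 0) :
    ∃ D : P × P → ℝ, (∀ᶠ x in 𝓝 (p, p'), ContDiffAt ℝ 1 D x) ∧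
      ∀ᶠ z : (P × P) × (ℝ × ℝ) in 𝓝 ((p, p'), V),
        inner ℝ (gap K z.1.1 z.1.2 z.2) (angleDeriv K (z.1.1, z.2.1)) = 0 →
        inner ℝ (gap K z.1.1 z.1.2 z.2) (angleDeriv K (z.1.2, z.2.2)) = 0 →
        commonNormal K z.1.1 z.1.2 z.2 ≠ 0 ∧
        D z.1 = inner ℝ (unitNormal K z.1.1 z.1.2 z.2) (gap K z.1.1 z.1.2 z.2) ∧
        ∀ η, fderiv ℝ D z.1 (η, 0) =
          inner ℝ (unitNormal K z.1.1 z.1.2 z.2) (paramDeriv K (z.1.1, z.2.1) η) := by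
  have hK1 := contDiffOn_angleDeriv hO hK
  let G : (P × P) × (ℝ × ℝ) → Space := fun z => gap K z.1.1 z.1.2 z.2
  let T : (P × P) × (ℝ × ℝ) → Space := fun z => angleDeriv K (z.1.1, z.2.1)
  let T' : (P × P) × (ℝ × ℝ) → Space := fun z => angleDeriv K (z.1.2, z.2.2)
  let Φ : (P × P) × (ℝ × ℝ) → ℝ × ℝ := fun z => (inner ℝ (G z) (T z), inner ℝ (G z) (T' z))
  have cG : ContDiffAt ℝ 1 G ((p, p'), V) :=
    (contDiffAt_family (q := fun z : (P × P) × (ℝ × ℝ) => z.1.1) (l := fun z => z.2.1) hO hK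
      (by fun_prop) (by fun_prop) hp).sub
      (contDiffAt_family (q := fun z : (P × P) × (ℝ × ℝ) => z.1.2) (l := fun z => z.2.2) hO hK
      (by fun_prop) (by fun_prop) hp')
  have cT : ContDiffAt ℝ 1 T ((p, p'), V) :=
    contDiffAt_family (q := fun z : (P × P) × (ℝ × ℝ) => z.1.1) (l := fun z => z.2.1) hO hK1
      (by fun_prop) (by fun_prop) hp
  have cT' : ContDiffAt ℝ 1 T' ((p, p'), V) :=
    contDiffAt_family (q := fun z : (P × P) × (ℝ × ℝ) => z.1.2) (l := fun z => z.2.2) hO hK1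
      (by fun_prop) (by fun_prop) hp'
  have cΦ : ContDiffAt ℝ 1 Φ ((p, p'), V) := (cG.inner ℝ cT).prodMk (cG.inner ℝ cT')
  have hG0 : G ((p, p'), V) = 0 := h0
  have dG := (cG.differentiableAt one_ne_zero).hasFDerivAt
  have dT := (cT.differentiableAt one_ne_zero).hasFDerivAt
  have dT' := (cT'.differentiableAt one_ne_zero).hasFDerivAt
  -- the partial derivative of the gap in the angles
  have hGw : ∀ w : ℝ × ℝ, fderiv ℝ G ((p, p'), V) (0, w) =
      w.1 • T ((p, p'), V) - w.2 • T' ((p, p'), V) := by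
    intro w
    have k1 := dG.comp V (hasFDerivAt_prodMk_right (𝕜 := ℝ) (p, p') V)
    have k2 := DFunLike.congr_fun (k1.unique (hasFDerivAt_gap hO hK hp hp' V)) w
    simpa using k2
  obtain ⟨g, cg, hg, -, hguniq⟩ := exists_implicit_function one_ne_zero cΦ
    (by simp only [Φ, hG0, inner_zero_left]; rfl) (by
      intro w hw
      have k := (dG.inner ℝ dT).prodMk (dG.inner ℝ dT')
      have hw' : fderiv ℝ Φ ((p, p'), V) (0, w) = _ := DFunLike.congr_fun k.fderiv (0, w)
      rw [hw] at hw'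
      have e1 := congrArg Prod.fst hw'
      have e2 := congrArg Prod.snd hw'
      simp [fderivInnerCLM_apply, hG0, hGw] at e1 e2
      set A := w.1 • T ((p, p'), V) - w.2 • T' ((p, p'), V) with hA
      have hAA : inner ℝ A A = 0 := by
        conv_lhs => rhs; rw [hA]
        rw [inner_sub_right, real_inner_smul_right, real_inner_smul_right, ← e1, ← e2]
        ring
      have := htr w.1 w.2 (sub_eq_zero.1 (inner_self_eq_zero.1 hAA))
      exact Prod.ext this.1 this.2)
  let n : P × P → Space := fun x => commonNormal K x.1 x.2 (g x)
  let N : P × P → Space := fun x => unitNormal K x.1 x.2 (g x)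
  let Γ : P × P → Space := fun x => gap K x.1 x.2 (g x)
  have hn0 : n (p, p') ≠ 0 := by
    simp only [n, hg]; exact cross_ne_zero htr
  have cid : ContDiffAt ℝ 1 (fun x : P × P => (x, g x)) (p, p') := contDiffAt_id.prodMk cg
  have cΓ : ContDiffAt ℝ 1 Γ (p, p') :=
    ContDiffAt.comp (g := G) (f := fun x : P × P => (x, g x)) (p, p') (by rw [hg]; exact cG) cid
  have cn : ContDiffAt ℝ 1 n (p, p') := contDiffAt_cross
    (ContDiffAt.comp (g := T) (f := fun x : P × P => (x, g x)) (p, p') (by rw [hg]; exact cT) cid)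
    (ContDiffAt.comp (g := T') (f := fun x : P × P => (x, g x)) (p, p')
      (by rw [hg]; exact cT') cid)
  have cN : ContDiffAt ℝ 1 N (p, p') :=
    ((cn.norm ℝ hn0).inv (norm_ne_zero_iff.2 hn0)).smul cn
  refine ⟨fun x => inner ℝ (N x) (Γ x), (cN.inner ℝ cΓ).eventually (by simp), ?_⟩
  have ev : ∀ᶠ x in 𝓝 (p, p'), (∀ᶠ y in 𝓝 x, n y ≠ 0) ∧ DifferentiableAt ℝ N x ∧
      DifferentiableAt ℝ Γ x ∧ DifferentiableAt ℝ g x ∧ x.1 ∈ O ∧ x.2 ∈ O := by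
    filter_upwards [(cn.continuousAt.eventually_ne hn0).eventually_nhds,
      cN.eventually (by simp), cΓ.eventually (by simp), cg.eventually (by simp),
      continuousAt_fst.eventually (hO.mem_nhds hp),
      continuousAt_snd.eventually (hO.mem_nhds hp')] with x h1 h2 h3 h4 h5 h6
    exact ⟨h1, h2.differentiableAt one_ne_zero, h3.differentiableAt one_ne_zero,
      h4.differentiableAt one_ne_zero, h5, h6⟩
  filter_upwards [hguniq, continuousAt_fst.eventually ev] with z hz hx c1 c2
  obtain ⟨⟨q, q'⟩, W⟩ := z
  obtain ⟨hn, dN, dΓ, dg, hq, hq'⟩ := hx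
  have hW : W = g (q, q') := hz (Prod.ext c1 c2)
  subst hW
  refine ⟨hn.self_of_nhds, rfl, fun η => ?_⟩
  have hD := dN.hasFDerivAt.inner ℝ dΓ.hasFDerivAt
  rw [hD.fderiv]
  simp only [ContinuousLinearMap.comp_apply, ContinuousLinearMap.prod_apply, fderivInnerCLM_apply]
  -- the unit normal turns orthogonally to itself
  have hNN : inner ℝ (N (q, q')) (fderiv ℝ N (q, q') (η, 0)) = 0 := by
    have hc : (fun x => inner ℝ (N x) (N x)) =ᶠ[𝓝 (q, q')] fun _ => (1 : ℝ) := by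
      filter_upwards [hn] with y hy using inner_unitNormal_self hy
    have h1 := (dN.hasFDerivAt.inner ℝ dN.hasFDerivAt).unique
      ((hasFDerivAt_const (1 : ℝ) (q, q')).congr_of_eventuallyEq hc)
    have h2 := DFunLike.congr_fun h1 (η, 0)
    simp only [ContinuousLinearMap.comp_apply, ContinuousLinearMap.prod_apply,
      fderivInnerCLM_apply] at h2
    rw [real_inner_comm] at h2
    simpa [real_inner_comm] using h2
  have hΓ : Γ (q, q') = inner ℝ (N (q, q')) (Γ (q, q')) • N (q, q') :=
    eq_inner_smul_unitNormal hn.self_of_nhds c1 c2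
  have t1 : inner ℝ (fderiv ℝ N (q, q') (η, 0)) (Γ (q, q')) = 0 := by
    rw [hΓ, real_inner_smul_right, real_inner_comm (N (q, q')) (fderiv ℝ N (q, q') (η, 0)), hNN,
      mul_zero]
  rw [t1, add_zero]
  -- the critical point moves along the curves
  have l1 : ContDiffAt ℝ 1 (fun z : P × ℝ => K z) (q, (g (q, q')).1) :=
    (hK.contDiffAt ((hO.prod isOpen_univ).mem_nhds ⟨hq, mem_univ _⟩)).of_le (by simp)
  have l2 : ContDiffAt ℝ 1 (fun z : P × ℝ => K z) (q', (g (q, q')).2) :=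
    (hK.contDiffAt ((hO.prod isOpen_univ).mem_nhds ⟨hq', mem_univ _⟩)).of_le (by simp)
  have d1 := HasFDerivAt.comp (f := fun x : P × P => (x.1, (g x).1)) (q, q')
    (l1.differentiableAt one_ne_zero).hasFDerivAt (hasFDerivAt_fst.prodMk dg.hasFDerivAt.fst)
  have d2 := HasFDerivAt.comp (f := fun x : P × P => (x.2, (g x).2)) (q, q')
    (l2.differentiableAt one_ne_zero).hasFDerivAt (hasFDerivAt_snd.prodMk dg.hasFDerivAt.snd)
  have hΓ' : fderiv ℝ Γ (q, q') = _ := (d1.sub d2).fderiv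
  have split : ∀ (r : P × ℝ) (u : P) (s : ℝ), fderiv ℝ K r (u, s) =
      paramDeriv K r u + s • angleDeriv K r := by
    intro r u s
    have : ((u, s) : P × ℝ) = (u, 0) + s • (0, 1) := by simp
    rw [this, map_add, map_smul]; rfl
  rw [hΓ']
  simp only [sub_apply, ContinuousLinearMap.comp_apply,
    ContinuousLinearMap.prod_apply, ContinuousLinearMap.coe_fst', ContinuousLinearMap.coe_snd',
    split, inner_sub_right, inner_add_right, real_inner_smul_right, map_zero, inner_zero_right]
  have i1 : inner ℝ (N (q, q')) (angleDeriv K (q, (g (q, q')).1)) = 0 :=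
    inner_unitNormal_left K q q' _
  have i2 : inner ℝ (N (q, q')) (angleDeriv K (q', (g (q, q')).2)) = 0 :=
    inner_unitNormal_right K q q' _
  rw [i1, i2]
  simp [N]

end SignedDistance

/-! ### Extension of the derivative -/

/-- A continuous function on an interval whose derivative off one point has a continuous
extension is of class `C¹`. -/
lemma contDiffOn_of_hasDerivAt_of_ne {s g : ℝ → ℝ} {ta tb tc : ℝ} (hc : tc ∈ Ioo ta tb)
    (hs : ContinuousOn s (Ioo ta tb)) (hg : ContinuousOn g (Ioo ta tb))
    (hd : ∀ t ∈ Ioo ta tb, t ≠ tc → HasDerivAt s (g t) t) : ContDiffOn ℝ 1 s (Ioo ta tb) := by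
  have hctc := hg.continuousAt (isOpen_Ioo.mem_nhds hc)
  have hstc := hs.continuousAt (isOpen_Ioo.mem_nhds hc)
  have dtc : HasDerivAt s (g tc) tc := by
    have hr : ∀ t ∈ Ioo tc tb, HasDerivAt s (g t) t := fun t ht =>
      hd t ⟨hc.1.trans ht.1, ht.2⟩ ht.1.ne'
    have hl : ∀ t ∈ Ioo ta tc, HasDerivAt s (g t) t := fun t ht =>
      hd t ⟨ht.1, ht.2.trans hc.2⟩ ht.2.ne
    have A : HasDerivWithinAt s (g tc) (Ici tc) tc := by
      refine hasDerivWithinAt_Ici_of_tendsto_deriv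
        (fun t ht => (hr t ht).differentiableAt.differentiableWithinAt) hstc.continuousWithinAt
        (Ioo_mem_nhdsGT hc.2) ?_
      refine (hctc.tendsto.mono_left nhdsWithin_le_nhds).congr' ?_
      filter_upwards [Ioo_mem_nhdsGT hc.2] with t ht using (hr t ht).deriv.symm
    have B : HasDerivWithinAt s (g tc) (Iic tc) tc := by
      refine hasDerivWithinAt_Iic_of_tendsto_deriv
        (fun t ht => (hl t ht).differentiableAt.differentiableWithinAt) hstc.continuousWithinAt
        (Ioo_mem_nhdsLT hc.1) ?_
      refine (hctc.tendsto.mono_left nhdsWithin_le_nhds).congr' ?_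
      filter_upwards [Ioo_mem_nhdsLT hc.1] with t ht using (hl t ht).deriv.symm
    simpa using B.union A
  have hall : ∀ t ∈ Ioo ta tb, HasDerivAt s (g t) t := fun t ht => by
    rcases eq_or_ne t tc with rfl | h
    · exact dtc
    · exact hd t ht h
  rw [show (1 : ℕ∞ω) = 0 + 1 by simp, contDiffOn_succ_iff_deriv_of_isOpen isOpen_Ioo]
  refine ⟨fun t ht => (hall t ht).differentiableAt.differentiableWithinAt, by simp, ?_⟩
  rw [contDiffOn_zero]
  exact hg.congr fun t ht => (hall t ht).deriv

/-! ### The averaged derivatives of the perturbing function -/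

lemma hasFDerivAt_perturbation {x z : Space} (h : x - z ≠ 0) (c : ℝ) :
    HasFDerivAt (fun x : Space => c * (1 / ‖x - z‖ - inner ℝ x z / ‖z‖ ^ 3))
      (innerSL ℝ (c • (-((‖x - z‖ ^ 3)⁻¹ • (x - z)) - (‖z‖ ^ 3)⁻¹ • z))) x := by
  have hn : ‖x - z‖ ≠ 0 := norm_ne_zero_iff.2 h
  have h1 : HasFDerivAt (fun x : Space => ‖x - z‖ ^ 2)
      (2 • (innerSL ℝ (x - z)).comp (ContinuousLinearMap.id ℝ Space)) x :=
    ((hasFDerivAt_id x).sub_const z).norm_sq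
  have h2 := (h1.sqrt (pow_ne_zero 2 hn))
  simp only [Real.sqrt_sq (norm_nonneg _)] at h2
  have h3 := (hasDerivAt_inv hn).comp_hasFDerivAt x h2
  have h4 : HasFDerivAt (fun x : Space => inner ℝ x z) (innerSL ℝ z) x := by
    refine (innerSL ℝ z).hasFDerivAt.congr_of_eventuallyEq (Eventually.of_forall fun y => ?_)
    exact real_inner_comm _ _
  have h5 := (h3.sub (h4.mul_const (‖z‖ ^ 3)⁻¹)).const_mul c
  refine (h5.congr_fderiv ?_).congr_of_eventuallyEq (Eventually.of_forall fun y => ?_)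
  · ext y
    simp
    field_simp
    simp
  · simp [div_eq_mul_inv]

/-- The derivative of the indirect part of the perturbing function when the elements of the first
orbit move with velocity `η`. -/
def indirectKernel (p p' η : ℝ × ℝ × ℝ × ℝ × ℝ) (V : ℝ × ℝ) : ℝ :=
  inner ℝ (paramDeriv orbitMap (p, V.1) η) (orbitMap (p', V.2)) / ‖orbitMap (p', V.2)‖ ^ 3

/-- The derivative of the Keplerian elements of the asteroid with respect to `Y`. -/
def elementsDeriv (k : ℝ) (E : Elements) : (Fin 4 → ℝ) →L[ℝ] ℝ × ℝ × ℝ × ℝ × ℝ :=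
  fderiv ℝ (fun X : Fin 4 → ℝ => keplerElements k (E.1, X)) E.2

lemma hasFDerivAt_keplerElements {E : Elements} (hE : E ∈ delaunayDomain) (k : ℝ) :
    HasFDerivAt (fun X : Fin 4 → ℝ => keplerElements k (E.1, X)) (elementsDeriv k E) E.2 :=
  ((contDiffAt_keplerElements (L := E.1) (Y := E.2) hE k).differentiableAt (by simp)).hasFDerivAt

lemma partialR_eq {k μ : ℝ} {C : Config} (hC : C.1 ∈ delaunayDomain) {V : ℝ × ℝ}
    (h : gap orbitMap (keplerElements k C.1) (keplerElements k C.2) V ≠ 0) (j : Fin 4) :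
    partialR k μ C V j = μ * k ^ 2 *
      (-singularKernel orbitMap (keplerElements k C.1) (keplerElements k C.2)
          (elementsDeriv k C.1 (Pi.single j 1)) V -
        indirectKernel (keplerElements k C.1) (keplerElements k C.2)
          (elementsDeriv k C.1 (Pi.single j 1)) V) := by
  have h1 : HasFDerivAt (fun X : Fin 4 → ℝ => orbitMap (keplerElements k (C.1.1, X), V.1))
      (paramDeriv orbitMap (keplerElements k C.1, V.1) ∘L elementsDeriv k C.1) C.1.2 :=
    HasFDerivAt.comp (g := fun q => orbitMap (q, V.1))
      (f := fun X : Fin 4 → ℝ => keplerElements k (C.1.1, X)) C.1.2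
      (hasFDerivAt_param isOpen_smoothElements contDiffOn_orbitMap
        (keplerElements_mem (delaunayDomain_subset hC) k) V.1) (hasFDerivAt_keplerElements hC k)
  have h2 := (hasFDerivAt_perturbation h (μ * k ^ 2)).comp C.1.2 h1
  have h3 : fderiv ℝ (fun Y : Fin 4 → ℝ => perturbingFunction k μ ((C.1.1, Y), C.2) V) C.1.2 = _ :=
    h2.fderiv
  rw [partialR, h3]
  simp only [ContinuousLinearMap.comp_apply, innerSL_apply_apply, real_inner_smul_left,
    inner_sub_left, inner_neg_left, singularKernel, indirectKernel, gap, div_eq_mul_inv,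
    real_inner_comm (orbitMap (keplerElements k C.2, V.2))]
  ring

lemma paramDeriv_orbitMap_add_two_pi {p : ℝ × ℝ × ℝ × ℝ × ℝ} (hp : p ∈ smoothElements) (l : ℝ) :
    paramDeriv orbitMap (p, l + 2 * Real.pi) = paramDeriv orbitMap (p, l) := by
  refine (hasFDerivAt_param isOpen_smoothElements contDiffOn_orbitMap hp _).unique
    ((hasFDerivAt_param isOpen_smoothElements contDiffOn_orbitMap hp l).congr_of_eventuallyEq ?_)
  filter_upwards [isOpen_smoothElements.mem_nhds hp] with q hq using orbitMap_add_two_pi hq l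

section

variable {p p' : ℝ × ℝ × ℝ × ℝ × ℝ}

lemma periodic_fst_singularKernel (hp : p ∈ smoothElements) (η : ℝ × ℝ × ℝ × ℝ × ℝ) (y : ℝ) :
    Function.Periodic (fun x => singularKernel orbitMap p p' η (x, y)) (2 * Real.pi) := fun x => by
  simp only [singularKernel, gap, orbitMap_add_two_pi hp, paramDeriv_orbitMap_add_two_pi hp]

lemma periodic_snd_singularKernel (hp' : p' ∈ smoothElements) (η : ℝ × ℝ × ℝ × ℝ × ℝ) (x : ℝ) :
    Function.Periodic (fun y => singularKernel orbitMap p p' η (x, y)) (2 * Real.pi) := fun y => by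
  simp only [singularKernel, gap, orbitMap_add_two_pi hp']

lemma continuous_singularKernel (hp : p ∈ smoothElements) (hp' : p' ∈ smoothElements)
    (η : ℝ × ℝ × ℝ × ℝ × ℝ) (h : ∀ V, gap orbitMap p p' V ≠ 0) :
    Continuous (singularKernel orbitMap p p' η) :=
  (continuous_inner_gap isOpen_smoothElements contDiffOn_orbitMap hp hp' η).div
    ((continuous_gap isOpen_smoothElements contDiffOn_orbitMap hp hp').norm.pow 3)
    fun V => pow_ne_zero 3 (norm_ne_zero_iff.2 (h V))

lemma continuousAt_indirectKernel {X : Type*} [TopologicalSpace X]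
    {q q' η : X → ℝ × ℝ × ℝ × ℝ × ℝ} {V : X → ℝ × ℝ} {x : X}
    (cq : ContinuousAt q x) (cq' : ContinuousAt q' x) (cη : ContinuousAt η x)
    (cV : ContinuousAt V x) (hq : q x ∈ smoothElements) (hq' : q' x ∈ smoothElements)
    (ha : 0 < (q' x).1) : ContinuousAt (fun x => indirectKernel (q x) (q' x) (η x) (V x)) x := by
  have k1 := continuousAt_comp_family isOpen_smoothElements
    (contDiffOn_paramDeriv isOpen_smoothElements contDiffOn_orbitMap) cq cV.fst hq
  have k2 := continuousAt_comp_family isOpen_smoothElements contDiffOn_orbitMap cq' cV.snd hq'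
  exact ((k1.clm_apply cη).inner k2).div (k2.norm.pow 3)
    (pow_ne_zero 3 (norm_ne_zero_iff.2 (orbitMap_ne_zero ha hq' _)))

end

/-- For orbits without common points, a linear combination of the averaged derivatives of `R` is
the average of a directional derivative of `R`. -/
lemma sum_averagedPartialR {k μ : ℝ} (hk : 0 < k) {C : Config} (hC : C ∈ configDomain)
    (h : ∀ V, gap orbitMap (keplerElements k C.1) (keplerElements k C.2) V ≠ 0) (w : Fin 4 → ℝ) :
    ∑ j, w j * averagedPartialR k μ C j = 1 / (2 * Real.pi) ^ 2 * (μ * k ^ 2) *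
      (-(∫ V in angleSquare, singularKernel orbitMap (keplerElements k C.1)
          (keplerElements k C.2) (elementsDeriv k C.1 w) V) -
        ∫ V in angleSquare, indirectKernel (keplerElements k C.1) (keplerElements k C.2)
          (elementsDeriv k C.1 w) V) := by
  obtain ⟨hC1, hC2⟩ := hC
  set p := keplerElements k C.1
  set p' := keplerElements k C.2
  set B := elementsDeriv k C.1
  have hp : p ∈ smoothElements := keplerElements_mem (delaunayDomain_subset hC1) k
  have hp' : p' ∈ smoothElements := keplerElements_mem hC2 k
  have i1 : ∀ η, IntegrableOn (singularKernel orbitMap p p' η) angleSquare := fun η =>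
    (continuous_singularKernel hp hp' η h).continuousOn.integrableOn_compact isCompact_angleSquare
  have i2 : ∀ η, IntegrableOn (indirectKernel p p' η) angleSquare := fun η =>
    (continuous_iff_continuousAt.2 fun V => continuousAt_indirectKernel continuousAt_const
      continuousAt_const continuousAt_const continuousAt_id hp hp'
      (keplerElements_fst_pos hC2 hk)).continuousOn.integrableOn_compact isCompact_angleSquare
  have hw : B w = ∑ j, w j • B (Pi.single j 1) := by
    conv_lhs => rw [pi_eq_sum_univ' w]
    simp [map_sum]
  have e1 : ∀ V, singularKernel orbitMap p p' (B w) V =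
      ∑ j, w j * singularKernel orbitMap p p' (B (Pi.single j 1)) V := fun V => by
    rw [hw]
    simp only [singularKernel, map_sum, map_smul, inner_sum, real_inner_smul_right,
      Finset.sum_div, mul_div_assoc]
  have e2 : ∀ V, indirectKernel p p' (B w) V =
      ∑ j, w j * indirectKernel p p' (B (Pi.single j 1)) V := fun V => by
    rw [hw]
    simp only [indirectKernel, map_sum, map_smul, sum_inner, real_inner_smul_left,
      Finset.sum_div, mul_div_assoc]
  simp only [e1, e2]
  rw [integral_finsetSum _ fun j _ => (i1 _).const_mul _,
    integral_finsetSum _ fun j _ => (i2 _).const_mul _, ← Finset.sum_neg_distrib,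
    ← Finset.sum_sub_distrib, Finset.mul_sum]
  refine Finset.sum_congr rfl fun j _ => ?_
  have e3 : ∫ V in angleSquare, partialR k μ C V j = ∫ V in angleSquare, μ * k ^ 2 *
      (-singularKernel orbitMap p p' (B (Pi.single j 1)) V -
        indirectKernel p p' (B (Pi.single j 1)) V) :=
    integral_congr_ae (Eventually.of_forall fun V => partialR_eq hC1 (h V) j)
  have e4 : ∫ V in angleSquare, (-singularKernel orbitMap p p' (B (Pi.single j 1)) V -
      indirectKernel p p' (B (Pi.single j 1)) V) =
      -(∫ V in angleSquare, singularKernel orbitMap p p' (B (Pi.single j 1)) V) -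
        ∫ V in angleSquare, indirectKernel p p' (B (Pi.single j 1)) V := by
    rw [← integral_neg]
    exact integral_sub (i1 _).neg (i2 _)
  rw [averagedPartialR, e3, integral_const_mul, e4, integral_const_mul, integral_const_mul]
  ring

/-! ### The signed distance along a solution -/

lemma separation_eq (k : ℝ) (C : Config) :
    separation k C = gap orbitMap (keplerElements k C.1) (keplerElements k C.2) := rfl

lemma keplerDist_eq (k : ℝ) (C : Config) :
    keplerDist k C = fun W => ‖gap orbitMap (keplerElements k C.1) (keplerElements k C.2) W‖ := rfl

lemma deriv_position {k : ℝ} {E : Elements} (hE : E ∈ ellipticDomain) (l : ℝ) :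
    deriv (position k E) l = angleDeriv orbitMap (keplerElements k E, l) :=
  (hasDerivAt_angle isOpen_smoothElements contDiffOn_orbitMap (keplerElements_mem hE k) l).deriv

lemma signedOrbitDist_eq {k : ℝ} {C : Config} (h1 : C.1 ∈ ellipticDomain)
    (h2 : C.2 ∈ ellipticDomain) (Vh : Config → ℝ × ℝ) :
    signedOrbitDist k Vh C =
      inner ℝ (unitNormal orbitMap (keplerElements k C.1) (keplerElements k C.2) (Vh C))
        (gap orbitMap (keplerElements k C.1) (keplerElements k C.2) (Vh C)) := by
  have hn : normalVector k C (Vh C) =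
      commonNormal orbitMap (keplerElements k C.1) (keplerElements k C.2) (Vh C) := by
    rw [normalVector, deriv_position h1, deriv_position h2]; rfl
  rw [signedOrbitDist, keplerDist, hn, separation_eq, unitNormal, real_inner_smul_right]
  rcases eq_or_ne (gap orbitMap (keplerElements k C.1) (keplerElements k C.2) (Vh C)) 0 with h | h
  · simp [h]
  · rw [mul_right_comm, inv_mul_cancel₀ (norm_ne_zero_iff.2 h), one_mul]

/-- Orbits with a common point have orbit distance zero. -/
lemma gap_ne_zero_of_orbitDist_ne_zero {k : ℝ} {C : Config} (h : orbitDist k C ≠ 0) (V : ℝ × ℝ) :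
    gap orbitMap (keplerElements k C.1) (keplerElements k C.2) V ≠ 0 := by
  intro h0
  have hV : keplerDist k C V = 0 := norm_eq_zero.2 h0
  refine h (IsLeast.csInf_eq ⟨⟨V, Eventually.of_forall fun W => ?_, hV.symm⟩, ?_⟩)
  · change keplerDist k C V ^ 2 ≤ keplerDist k C W ^ 2
    rw [hV, zero_pow two_ne_zero]
    positivity
  · rintro r ⟨W, -, rfl⟩
    exact norm_nonneg _

lemma continuousOn_elements {k : ℝ} (hk : 0 < k) {I : Set ℝ} {E' : ℝ → Elements}
    (hE' : ∀ t ∈ I, E' t ∈ ellipticDomain)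
    (hc : ContinuousOn (fun t => keplerElements k (E' t)) I) : ContinuousOn E' I :=
  ((continuous_delaunayElements k).comp_continuousOn hc).congr fun t ht =>
    (delaunayElements_keplerElements (hE' t ht) hk).symm

lemma continuousAt_elementsDeriv {E : Elements} (hE : E ∈ delaunayDomain) (k : ℝ) :
    ContinuousAt (fun X : Fin 4 → ℝ => elementsDeriv k (E.1, X)) E.2 :=
  ((contDiffAt_keplerElements (L := E.1) (Y := E.2) hE k).fderiv_right
    (m := 0) (by simp)).continuousAt

lemma eq_zero_of_gap_eq_zero {k : ℝ} (hk : 0 < k) {C : Config} (h1 : C.1 ∈ ellipticDomain)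
    (h2 : C.2 ∈ ellipticDomain) (hone : HasOneCrossingPoint k C) {V v : ℝ × ℝ}
    (hV : gap orbitMap (keplerElements k C.1) (keplerElements k C.2) V = 0) (hv : v ∈ angleSquare)
    (hVv : gap orbitMap (keplerElements k C.1) (keplerElements k C.2) (V + v) = 0) : v = 0 := by
  have e1 := sub_eq_zero.1 hV
  have e2 := sub_eq_zero.1 hVv
  have e : orbitMap (keplerElements k C.1, (V + v).1) = orbitMap (keplerElements k C.1, V.1) :=
    hone.unique ⟨⟨(V + v).1, rfl⟩, ⟨(V + v).2, e2.symm⟩⟩ ⟨⟨V.1, rfl⟩, ⟨V.2, e1.symm⟩⟩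
  have e' : orbitMap (keplerElements k C.2, (V + v).2) = orbitMap (keplerElements k C.2, V.2) :=
    e2.symm.trans (e.trans e1)
  rw [mem_angleSquare] at hv
  exact Prod.ext
    (eq_zero_of_orbitMap_eq (keplerElements_fst_pos h1 hk) (keplerElements_mem h1 k) hv.1 e)
    (eq_zero_of_orbitMap_eq (keplerElements_fst_pos h2 hk) (keplerElements_mem h2 k) hv.2 e')

/-- The Hamiltonian vector field with Hamiltonian differential `c`, in the coordinates
`(G, Z, g, z)`, up to sign. -/
def symplecticGradient (c : Fin 4 → ℝ) : Fin 4 → ℝ := ![-c 2, -c 3, c 0, c 1]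

lemma sum_mul_symplecticGradient (c : Fin 4 → ℝ) : ∑ j, symplecticGradient c j * c j = 0 := by
  simp [Fin.sum_univ_four, symplecticGradient]; ring

/-- The gradient, with respect to the elements `Y` of the asteroid, of the component of its
position along the common normal of the two orbits at `V`. -/
def normalGradient (k : ℝ) (C : Config) (V : ℝ × ℝ) (j : Fin 4) : ℝ :=
  inner ℝ (unitNormal orbitMap (keplerElements k C.1) (keplerElements k C.2) V)
    (paramDeriv orbitMap (keplerElements k C.1, V.1) (elementsDeriv k C.1 (Pi.single j 1)))

/-- The velocity of the Keplerian elements of the asteroid under the Hamiltonian flow of the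
normal displacement. It leaves the normal displacement stationary. -/
def tangentVelocity (k : ℝ) (C : Config) (V : ℝ × ℝ) : ℝ × ℝ × ℝ × ℝ × ℝ :=
  elementsDeriv k C.1 (symplecticGradient (normalGradient k C V))

lemma inner_unitNormal_paramDeriv (k : ℝ) (C : Config) (V : ℝ × ℝ) (y : Fin 4 → ℝ) :
    inner ℝ (unitNormal orbitMap (keplerElements k C.1) (keplerElements k C.2) V)
      (paramDeriv orbitMap (keplerElements k C.1, V.1) (elementsDeriv k C.1 y)) =
      ∑ j, y j * normalGradient k C V j := by
  conv_lhs => rw [pi_eq_sum_univ' y]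
  simp [map_sum, inner_sum, real_inner_smul_right, normalGradient]

lemma inner_unitNormal_tangentVelocity (k : ℝ) (C : Config) (V : ℝ × ℝ) :
    inner ℝ (unitNormal orbitMap (keplerElements k C.1) (keplerElements k C.2) V)
      (paramDeriv orbitMap (keplerElements k C.1, V.1) (tangentVelocity k C V)) = 0 := by
  rw [tangentVelocity, inner_unitNormal_paramDeriv, sum_mul_symplecticGradient]

lemma continuousAt_tangentVelocity {k L t : ℝ} {Y : ℝ → Fin 4 → ℝ} {E' : ℝ → Elements}
    {V : ℝ → ℝ × ℝ} (hY : (L, Y t) ∈ delaunayDomain) (hE' : E' t ∈ ellipticDomain)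
    (cY : ContinuousAt Y t) (cE' : ContinuousAt (fun t => keplerElements k (E' t)) t)
    (cV : ContinuousAt V t) (hn : commonNormal orbitMap (keplerElements k (L, Y t))
      (keplerElements k (E' t)) (V t) ≠ 0) :
    ContinuousAt (fun t => tangentVelocity k ((L, Y t), E' t) (V t)) t := by
  have hO := isOpen_smoothElements
  have hK := contDiffOn_orbitMap
  have hp := keplerElements_mem (delaunayDomain_subset hY) k
  have hp' := keplerElements_mem hE' k
  have cp : ContinuousAt (fun t => keplerElements k (L, Y t)) t :=
    ContinuousAt.comp (g := fun X : Fin 4 → ℝ => keplerElements k (L, X)) (f := Y)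
      (contDiffAt_keplerElements hY k).continuousAt cY
  have cA : ContinuousAt (fun t => elementsDeriv k (L, Y t)) t :=
    ContinuousAt.comp (g := fun X : Fin 4 → ℝ => elementsDeriv k (L, X)) (f := Y)
      (continuousAt_elementsDeriv hY k) cY
  have cc : ∀ j, ContinuousAt (fun t => normalGradient k ((L, Y t), E' t) (V t) j) t := fun j =>
    (continuousAt_unitNormal hO hK cp cE' cV hp hp' hn).inner
      ((continuousAt_comp_family hO (contDiffOn_paramDeriv hO hK) cp cV.fst hp).clm_apply
        (cA.clm_apply continuousAt_const))
  refine cA.clm_apply (continuousAt_pi.2 fun j => ?_)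
  fin_cases j
  · exact (cc 2).neg
  · exact (cc 3).neg
  · exact cc 0
  · exact cc 1

lemma sum_mul_averagedField (k μ : ℝ) (C : Config) (c : Fin 4 → ℝ) :
    ∑ j, averagedField k μ C j * c j =
      ∑ j, symplecticGradient c j * averagedPartialR k μ C j := by
  simp [Fin.sum_univ_four, symplecticGradient, averagedField]; ring

/-- The normal component of the displacement produced by the averaged vector field is, by the
antisymmetry of the Hamiltonian equations, the average of the derivative of `R` along the tangent
velocity. -/
lemma inner_unitNormal_averagedField {k μ : ℝ} (hk : 0 < k) {C : Config} (hC : C ∈ configDomain)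
    (h : ∀ U, gap orbitMap (keplerElements k C.1) (keplerElements k C.2) U ≠ 0) (V : ℝ × ℝ) :
    inner ℝ (unitNormal orbitMap (keplerElements k C.1) (keplerElements k C.2) V)
      (paramDeriv orbitMap (keplerElements k C.1, V.1)
        (elementsDeriv k C.1 (averagedField k μ C))) =
      1 / (2 * Real.pi) ^ 2 * (μ * k ^ 2) *
        (-(1 / 2 * ∫ v in angleSquare,
            (singularKernel orbitMap (keplerElements k C.1) (keplerElements k C.2)
              (tangentVelocity k C V) (V + v) +
            singularKernel orbitMap (keplerElements k C.1) (keplerElements k C.2)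
              (tangentVelocity k C V) (V - v))) -
          ∫ v in angleSquare, indirectKernel (keplerElements k C.1) (keplerElements k C.2)
            (tangentVelocity k C V) v) := by
  have hp := keplerElements_mem (delaunayDomain_subset hC.1) k
  have hp' := keplerElements_mem hC.2 k
  rw [inner_unitNormal_paramDeriv, sum_mul_averagedField, sum_averagedPartialR hk hC h,
    ← tangentVelocity, setIntegral_angleSquare_symm
      (continuous_singularKernel hp hp' (tangentVelocity k C V) h)
      (periodic_fst_singularKernel hp _) (periodic_snd_singularKernel hp' _) V]

end SecularOrbit

end
open SecularOrbit in
theorem proposition4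
    (k μ a : ℝ) (hk : 0 < k) (hμ : 0 < μ) (ha : 0 < a)
    (I : Set ℝ) (hI_open : IsOpen I) (hI_interval : I.OrdConnected)
    (E' : ℝ → Elements) (hE'_mem : ∀ t ∈ I, E' t ∈ ellipticDomain)
    (hE' : ContDiffOn ℝ 1 (fun t => keplerElements k (E' t)) I)
    (Y : ℝ → Fin 4 → ℝ) (hY : IsGeneralizedSolution k μ a E' I Y)
    (tc : ℝ) (htc : tc ∈ crossingTimes k a E' I Y)
    (hnd : IsNondegenerate k (evolution k a E' Y tc))
    (hone : HasOneCrossingPoint k (evolution k a E' Y tc))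
    (W : Set Config) (hW : W ∈ 𝓝[configDomain] (evolution k a E' Y tc))
    (Vh : Config → ℝ × ℝ) (hVh : IsMinimumBranch k W Vh)
    (hh : keplerDist k (evolution k a E' Y tc) (Vh (evolution k a E' Y tc)) = 0) :
    ∃ ta tb : ℝ, ta < tc ∧ tc < tb ∧ Ioo ta tb ⊆ I ∧
      (∀ t ∈ Ioo ta tb, evolution k a E' Y t ∈ W) ∧
      ContDiffOn ℝ 1 (fun t => signedOrbitDist k Vh (evolution k a E' Y t)) (Ioo ta tb) := by
  have htI : tc ∈ I := htc.1
  have hO := isOpen_smoothElements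
  have hK := contDiffOn_orbitMap
  set L := k * Real.sqrt a with hL
  set C : ℝ → Config := evolution k a E' Y with hC
  set p : ℝ → ℝ × ℝ × ℝ × ℝ × ℝ := fun t => keplerElements k (L, Y t) with hp
  set p' : ℝ → ℝ × ℝ × ℝ × ℝ × ℝ := fun t => keplerElements k (E' t) with hp'
  set V : ℝ → ℝ × ℝ := fun t => Vh (C t) with hV
  have hdel : ∀ t ∈ I, (L, Y t) ∈ delaunayDomain := hY.mem_domain
  have hell : ∀ t ∈ I, (L, Y t) ∈ ellipticDomain := fun t ht => delaunayDomain_subset (hdel t ht)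
  have memP : ∀ t ∈ I, p t ∈ smoothElements := fun t ht => keplerElements_mem (hell t ht) k
  have memP' : ∀ t ∈ I, p' t ∈ smoothElements := fun t ht => keplerElements_mem (hE'_mem t ht) k
  have cY : ∀ t ∈ I, ContinuousAt Y t := fun t ht =>
    hY.continuousOn.continuousAt (hI_open.mem_nhds ht)
  have cp : ∀ t ∈ I, ContinuousAt p t := fun t ht =>
    ContinuousAt.comp (g := fun X : Fin 4 → ℝ => keplerElements k (L, X)) (f := Y)
      (contDiffAt_keplerElements (hdel t ht) k).continuousAt (cY t ht)
  have cp' : ∀ t ∈ I, ContinuousAt p' t := fun t ht =>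
    hE'.continuousOn.continuousAt (hI_open.mem_nhds ht)
  have cC : ∀ t ∈ I, ContinuousAt C t := fun t ht =>
    (continuousAt_const.prodMk (cY t ht)).prodMk
      ((continuousOn_elements hk hE'_mem hE'.continuousOn).continuousAt (hI_open.mem_nhds ht))
  have hCdom : ∀ t ∈ I, C t ∈ configDomain := fun t ht => ⟨hdel t ht, hE'_mem t ht⟩
  have hCW : ∀ᶠ t in 𝓝 tc, C t ∈ W :=
    (tendsto_nhdsWithin_iff.2 ⟨cC tc htI, by
      filter_upwards [hI_open.mem_nhds htI] with t ht using hCdom t ht⟩).eventually hW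
  -- the crossing
  have hmin : ∀ t, C t ∈ W → IsLocalMin (fun U => ‖gap orbitMap (p t) (p' t) U‖ ^ 2) (V t) :=
    fun t ht => by
      have := hVh.isLocalMin _ ht
      rwa [keplerDist_eq] at this
  have hnd' : ∀ U : ℝ × ℝ, fderiv ℝ (fun U => ‖gap orbitMap (p tc) (p' tc) U‖ ^ 2) U = 0 →
      ∀ w : ℝ × ℝ, fderiv ℝ (fderiv ℝ (fun U => ‖gap orbitMap (p tc) (p' tc) U‖ ^ 2)) U w = 0 →
        w = 0 := by
    rwa [IsNondegenerate, keplerDist_eq] at hnd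
  have gap0 : gap orbitMap (p tc) (p' tc) (V tc) = 0 := norm_eq_zero.1 hh
  have htr := transversal_of_nondegenerate hO hK (memP tc htI) (memP' tc htI) gap0
    (hnd' (V tc) (hmin tc hCW.self_of_nhds).fderiv_eq_zero)
  obtain ⟨D, hD1, hD2⟩ := exists_signed_distance hO hK (memP tc htI) (memP' tc htI) gap0 htr
  have cVtc : ContinuousAt V tc :=
    (hVh.continuousOn _ hCW.self_of_nhds).tendsto.comp
      (tendsto_nhdsWithin_iff.2 ⟨cC tc htI, hCW⟩)
  have hev1 := ((cp tc htI).prodMk (cp' tc htI)).eventually hD1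
  have hev2 := (((cp tc htI).prodMk (cp' tc htI)).prodMk cVtc).eventually hD2
  have hev3 := eventually_nhdsWithin_iff.1 (hY.isolated tc htc)
  have hevI : ∀ᶠ t in 𝓝 tc, t ∈ I := hI_open.mem_nhds htI
  obtain ⟨ua, ub, hu, hgood⟩ := mem_nhds_iff_exists_Ioo_subset.1
    (hevI.and (hCW.and (hev1.and (hev2.and hev3))))
  set J := Ioo ua ub
  have hJI : ∀ t ∈ J, t ∈ I := fun t ht => (hgood ht).1
  have hJW : ∀ t ∈ J, C t ∈ W := fun t ht => (hgood ht).2.1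
  have hJD : ∀ t ∈ J, ContDiffAt ℝ 1 D (p t, p' t) := fun t ht => (hgood ht).2.2.1
  have crit : ∀ t ∈ J, _ := fun t ht => inner_gap_of_isLocalMin hO hK (memP t (hJI t ht))
    (memP' t (hJI t ht)) (hmin t (hJW t ht))
  have hJsd : ∀ t ∈ J, _ := fun t ht => (hgood ht).2.2.2.1 (crit t ht).1 (crit t ht).2
  have hJgap : ∀ t ∈ J, t ≠ tc → ∀ U, gap orbitMap (p t) (p' t) U ≠ 0 := fun t ht hne =>
    gap_ne_zero_of_orbitDist_ne_zero (C := C t) fun h0 => (hgood ht).2.2.2.2 hne ⟨hJI t ht, h0⟩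
  have cV : ∀ t ∈ J, ContinuousAt V t := fun t ht =>
    (hVh.continuousOn _ (hJW t ht)).tendsto.comp
      (tendsto_nhdsWithin_iff.2 ⟨cC t (hJI t ht), by
        filter_upwards [isOpen_Ioo.mem_nhds ht] with s hs using hJW s hs⟩)
  set η : ℝ → ℝ × ℝ × ℝ × ℝ × ℝ := fun t => tangentVelocity k (C t) (V t) with hη
  have cη : ∀ t ∈ J, ContinuousAt η t := fun t ht => continuousAt_tangentVelocity
    (hdel t (hJI t ht)) (hE'_mem t (hJI t ht)) (cY t (hJI t ht)) (cp' t (hJI t ht)) (cV t ht)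
    (hJsd t ht).1
  have data : CrossingData orbitMap smoothElements J tc p p' η V :=
    { isOpen_dom := hO
      smooth := hK
      isOpen_times := isOpen_Ioo
      mem_times := hu
      contP := fun t ht => (cp t (hJI t ht)).continuousWithinAt
      contP' := fun t ht => (cp' t (hJI t ht)).continuousWithinAt
      contEta := fun t ht => (cη t ht).continuousWithinAt
      contV := fun t ht => (cV t ht).continuousWithinAt
      memP := fun t ht => memP t (hJI t ht)
      memP' := fun t ht => memP' t (hJI t ht)
      crit₁ := fun t ht => (crit t ht).1
      crit₂ := fun t ht => (crit t ht).2
      stationary := fun t ht => by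
        rw [eq_inner_smul_unitNormal (hJsd t ht).1 (crit t ht).1 (crit t ht).2,
          real_inner_smul_left]
        exact mul_eq_zero_of_right _ (inner_unitNormal_tangentVelocity k (C t) (V t))
      transversal := htr
      unique := fun v hv hv0 =>
        eq_zero_of_gap_eq_zero (C := C tc) hk (hell tc htI) (hE'_mem tc htI) hone gap0 hv hv0 }
  obtain ⟨M, hM, hMc⟩ := data.exists_continuousOn_integral
  have hind : ContinuousOn (fun t => ∫ v in angleSquare, indirectKernel (p t) (p' t) (η t) v) J :=
    continuousOn_setIntegral_angleSquare (fun t ht v => by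
      have hf : ContinuousAt (fun z : ℝ × (ℝ × ℝ) => z.1) (t, v) := continuousAt_fst
      exact continuousAt_indirectKernel
        (ContinuousAt.comp (g := p) (f := fun z : ℝ × (ℝ × ℝ) => z.1) (cp t (hJI t ht)) hf)
        (ContinuousAt.comp (g := p') (f := fun z : ℝ × (ℝ × ℝ) => z.1) (cp' t (hJI t ht)) hf)
        (ContinuousAt.comp (g := η) (f := fun z : ℝ × (ℝ × ℝ) => z.1) (cη t ht) hf) continuousAt_snd
        (memP t (hJI t ht)) (memP' t (hJI t ht))
        (keplerElements_fst_pos (hE'_mem t (hJI t ht)) hk)) isOpen_Ioo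
  have hdp' : ContinuousOn (deriv p') I := hE'.continuousOn_deriv_of_isOpen hI_open le_rfl
  have cD' : ContinuousOn (fun t => fderiv ℝ D (p t, p' t) (0, deriv p' t)) J := fun t ht =>
    ((ContinuousAt.comp (g := fderiv ℝ D) (f := fun t => (p t, p' t))
      ((hJD t ht).fderiv_right (m := 0) (by simp)).continuousAt
      ((cp t (hJI t ht)).prodMk (cp' t (hJI t ht)))).clm_apply
      (continuousAt_const.prodMk
        (hdp'.continuousAt (hI_open.mem_nhds (hJI t ht))))).continuousWithinAt
  obtain ⟨ta, tb, ht, hsub⟩ := mem_nhds_iff_exists_Ioo_subset.1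
    (inter_mem (isOpen_Ioo.mem_nhds hu : J ∈ 𝓝 tc) hM)
  have hTJ : Ioo ta tb ⊆ J := fun t ht => (hsub ht).1
  have hTM : Ioo ta tb ⊆ M := fun t ht => (hsub ht).2
  refine ⟨ta, tb, ht.1, ht.2, fun t ht => hJI t (hTJ ht), fun t ht => hJW t (hTJ ht), ?_⟩
  have hs : ∀ t ∈ Ioo ta tb, signedOrbitDist k Vh (C t) = D (p t, p' t) := fun t ht => by
    rw [(hJsd t (hTJ ht)).2.1]
    exact signedOrbitDist_eq (C := C t) (hell t (hJI t (hTJ ht))) (hE'_mem t (hJI t (hTJ ht))) Vh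
  refine ContDiffOn.congr ?_ hs
  refine contDiffOn_of_hasDerivAt_of_ne ht (g := fun t => 1 / (2 * Real.pi) ^ 2 * (μ * k ^ 2) *
    (-(1 / 2 * ∫ v in angleSquare, (singularKernel orbitMap (p t) (p' t) (η t) (V t + v) +
        singularKernel orbitMap (p t) (p' t) (η t) (V t - v))) -
      ∫ v in angleSquare, indirectKernel (p t) (p' t) (η t) v) +
      fderiv ℝ D (p t, p' t) (0, deriv p' t)) ?_ ?_ ?_
  · exact fun t ht => (ContinuousAt.comp (g := D) (f := fun t => (p t, p' t))
      (hJD t (hTJ ht)).continuousAt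
      ((cp t (hJI t (hTJ ht))).prodMk (cp' t (hJI t (hTJ ht))))).continuousWithinAt
  · exact (continuousOn_const.mul (((continuousOn_const.mul (hMc.mono hTM)).neg).sub
      (hind.mono hTJ))).add (cD'.mono hTJ)
  · intro t htT hne
    have htJ := hTJ htT
    have htI' := hJI t htJ
    have hgap := hJgap t htJ hne
    have dY := hY.solves t ⟨htI', fun h => (hgood htJ).2.2.2.2 hne h⟩
    have dp : HasDerivAt p (elementsDeriv k (C t).1 (averagedField k μ (C t))) t :=
      HasFDerivAt.comp_hasDerivAt (f := Y) (l := fun X : Fin 4 → ℝ => keplerElements k (L, X)) t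
        (hasFDerivAt_keplerElements (E := (L, Y t)) (hdel t htI') k) dY
    have dp' : HasDerivAt p' (deriv p' t) t :=
      ((hE'.contDiffAt (hI_open.mem_nhds htI')).differentiableAt one_ne_zero).hasDerivAt
    have dD := HasFDerivAt.comp_hasDerivAt (f := fun t => (p t, p' t)) t
      ((hJD t htJ).differentiableAt one_ne_zero).hasFDerivAt (dp.prodMk dp')
    refine dD.congr_deriv ?_
    have split : ((elementsDeriv k (C t).1 (averagedField k μ (C t)), deriv p' t) :
        (ℝ × ℝ × ℝ × ℝ × ℝ) × (ℝ × ℝ × ℝ × ℝ × ℝ)) =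
        (elementsDeriv k (C t).1 (averagedField k μ (C t)), 0) + (0, deriv p' t) := by simp
    rw [split, map_add, (hJsd t htJ).2.2]
    congr 1
    exact inner_unitNormal_averagedField hk (hCdom t htI') hgap (V t)
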